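/- Let $I\subset\mathbb R$ be an open interval, $f:I\to\mathbb R$ a smooth nowhere vanishing function, and let $L^4_1(f,0)=I\times\mathbb E^3$ carry the Lorentzian warped product metric $\tilde g=-dt^2+f(t)^2g_0$, where $g_0$ is the Euclidean metric. Let $\phi:M\to L^4_1(f,0)$ be a smooth space-like immersion of a connected smooth surface $M$ whose $t$-coordinate $\mathcal T=t\circ\phi$ satisfies $d\mathcal T\ne0$ at some point of $M$. Decompose $\partial/\partial t=\phi_*T+\eta$ along $\phi$ with $T$ tangent and $\eta$ normal. Then $\eta$ is parallel in the normal bundle ($\nabla^\perp\eta=0$) if and only if there is a dense open set $U\subset M$ such that every point of $U$ has a neighbourhood with smooth coordinates $(u,v)$ in which, after a rigid motion $(t,x)\mapsto(t,Ax)$ ($A$ an isometry of $\mathbb E^3$), $\phi$ is given by one of the following: (i) the cylinder $$\phi(u,v)=\Bigl(u,\;c_1\int_{u_0}^u\frac{d\xi}{f(\xi)},\;c_2\int_{u_0}^u\frac{d\xi}{f(\xi)}+c_3,\;v\Bigr)$$ for some constants $u_0\in I$ and $c_1,c_2,c_3\in\mathbb R$; (ii) the surface $$\phi(u,v)=\bigl(u,\;A_1(v)\,\alpha(v)+A_2(u,v)\,\alpha'(v)+A_3(u,v)\,n(v)\bigr),$$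 where $\alpha:J\to\mathbb S^2$ is a smooth curve parameterized by arc length on an open interval $J$, with unit normal $n$ and curvature $\kappa$ in $\mathbb S^2$ (so $\alpha''=\kappa n-\alpha$), and $$A_2(u,v)=c\sin\tau(v)\int_{u_0}^u\frac{d\xi}{f(\xi)}+A_4(v),\qquad A_3(u,v)=c\cos\tau(v)\int_{u_0}^u\frac{d\xi}{f(\xi)}+A_5(v)$$ for constants $u_0\in I$, $c\in\mathbb R$ and smooth functions $\tau,A_1,A_4,A_5$ on $J$ with $\tau'=\kappa$, $A_4'=\kappa A_5-A_1$ and $A_5'=-\kappa A_4$. -/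

import Mathlib

open scoped Manifold ContDiff

noncomputable section

namespace RobertsonWalker

/-- Euclidean three-space. -/
abbrev E3 := EuclideanSpace ℝ (Fin 3)

/-- The coordinate space `ℝ × 𝔼³`; the Robertson-Walker space-time `L⁴₁(f,0)` is its open subset
`I × 𝔼³` with the metric `metric f` below. Tangent vectors are pairs `(X₀, X̄)`. -/
abbrev RW := ℝ × E3

/-- The warped product metric `-dt² + f(t)² g₀` at the point `q`. -/
def metric (f : ℝ → ℝ) (q X Y : RW) : ℝ :=
  -(X.1 * Y.1) + f q.1 ^ 2 * inner ℝ X.2 Y.2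

/-- The Christoffel map of the metric at `q`:
`(ln f)' (g(X̄,Ȳ) ∂ₜ + X₀ Ȳ + Y₀ X̄)`. -/
def christoffel (f : ℝ → ℝ) (q X Y : RW) : RW :=
  (deriv f q.1 / f q.1) • (f q.1 ^ 2 * inner ℝ X.2 Y.2, X.1 • Y.2 + Y.1 • X.2)

/-- The Christoffel map is torsion free. -/
theorem christoffel_symm (f : ℝ → ℝ) (q X Y : RW) :
    christoffel f q X Y = christoffel f q Y X := by
  simp only [christoffel]
  rw [real_inner_comm, add_comm]

/-- The Christoffel map is compatible with the metric; together with `christoffel_symm` this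
says that it is the Christoffel map of the Levi-Civita connection. -/
theorem christoffel_compatible (f : ℝ → ℝ) (q X Y Z : RW) (hf : DifferentiableAt ℝ f q.1)
    (h0 : f q.1 ≠ 0) :
    HasDerivAt (fun s : ℝ => metric f (q + s • X) Y Z)
      (metric f q (christoffel f q X Y) Z + metric f q Y (christoffel f q X Z)) 0 := by
  have h1 : HasDerivAt (fun s : ℝ => q.1 + s * X.1) X.1 0 := by
    simpa using ((hasDerivAt_id (0 : ℝ)).mul_const X.1).const_add q.1
  have h2 : HasDerivAt f (deriv f q.1) (q.1 + 0 * X.1) := by simpa using hf.hasDerivAt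
  have h3 := (((h2.comp (0 : ℝ) h1).pow 2).mul_const (inner ℝ Y.2 Z.2)).const_add
    (-(Y.1 * Z.1))
  refine h3.congr_deriv ?_
  simp only [christoffel, metric, Prod.smul_fst, Prod.smul_snd, inner_smul_left,
    inner_smul_right, inner_add_left, inner_add_right, smul_eq_mul, Function.comp]
  rw [real_inner_comm Y.2 X.2]
  field_simp
  simp only [zero_mul, add_zero]
  norm_num
  field_simp
  ring

variable {M : Type*} [TopologicalSpace M] [ChartedSpace (EuclideanSpace ℝ (Fin 2)) M]

/-- The differential `φ_*` of a map `φ : M → ℝ × 𝔼³` at `p`. -/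
def differential (φ : M → RW) (p : M) : TangentSpace (𝓡 2) p →L[ℝ] RW :=
  mfderiv (𝓡 2) 𝓘(ℝ, RW) φ p

/-- `φ : M → L⁴₁(f,0)` is a smooth space-like immersion of the two-manifold `M`: the induced
metric is positive definite (so that the differential is injective). -/
structure IsSpacelikeSurface (I : Set ℝ) (f : ℝ → ℝ) (φ : M → RW) : Prop where
  mem : ∀ p, (φ p).1 ∈ I
  smooth : ContMDiff (𝓡 2) 𝓘(ℝ, RW) ∞ φ
  pos : ∀ (p : M) (X : TangentSpace (𝓡 2) p), X ≠ 0 →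
    0 < metric f (φ p) (differential φ p X) (differential φ p X)

/-- The tangential part of a vector `W` at `φ p`: the tangent vector `X` of `M` at `p` for which
`W - φ_* X` is normal to the surface. It exists and is unique on a space-like surface, see
`metric_normalPart` and `eq_tangentialPart`. -/
def tangentialPart (f : ℝ → ℝ) (φ : M → RW) (p : M) (W : RW) : TangentSpace (𝓡 2) p :=
  Classical.epsilon fun X : TangentSpace (𝓡 2) p =>
    ∀ Y : TangentSpace (𝓡 2) p,
      metric f (φ p) (W - differential φ p X) (differential φ p Y) = 0

/-- The normal part of a vector `W` at `φ p`. -/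
def normalPart (f : ℝ → ℝ) (φ : M → RW) (p : M) (W : RW) : RW :=
  W - differential φ p (tangentialPart f φ p W)

theorem exists_tangential {V : Type*} [AddCommGroup V] [Module ℝ V] [FiniteDimensional ℝ V]
    (f : ℝ → ℝ) (q : RW) (L : V →ₗ[ℝ] RW) (hL : ∀ X, X ≠ 0 → 0 < metric f q (L X) (L X))
    (W : RW) : ∃ X, ∀ Y, metric f q (W - L X) (L Y) = 0 := by
  let G : RW →ₗ[ℝ] RW →ₗ[ℝ] ℝ := LinearMap.mk₂ ℝ (metric f q)
    (by intros; simp [metric, inner_add_left]; ring)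
    (by intros; simp [metric, inner_smul_left]; ring)
    (by intros; simp [metric, inner_add_right]; ring)
    (by intros; simp [metric, inner_smul_right]; ring)
  let B : V →ₗ[ℝ] Module.Dual ℝ V := G.compl₁₂ L L
  have hB : Function.Injective B := by
    rw [← LinearMap.ker_eq_bot, LinearMap.ker_eq_bot']
    intro X hX
    by_contra h
    have h1 : metric f q (L X) (L X) = 0 := LinearMap.congr_fun hX X
    exact (hL X h).ne' h1
  have hS : Function.Surjective B :=
    (LinearMap.injective_iff_surjective_of_finrank_eq_finrank
      (Subspace.dual_finrank_eq (K := ℝ) (V := V)).symm).1 hB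
  obtain ⟨X, hX⟩ := hS ((G W).comp L)
  refine ⟨X, fun Y => ?_⟩
  have h1 : G (L X) (L Y) = G W (L Y) := LinearMap.congr_fun hX Y
  have h2 : G (W - L X) (L Y) = 0 := by rw [map_sub, LinearMap.sub_apply, h1, sub_self]
  exact h2

theorem metric_normalPart {I : Set ℝ} {f : ℝ → ℝ} {φ : M → RW} (h : IsSpacelikeSurface I f φ)
    (p : M) (W : RW) (Y : TangentSpace (𝓡 2) p) :
    metric f (φ p) (normalPart f φ p W) (differential φ p Y) = 0 := by
  have : FiniteDimensional ℝ (TangentSpace (𝓡 2) p) :=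
    inferInstanceAs (FiniteDimensional ℝ (EuclideanSpace ℝ (Fin 2)))
  have h1 : ∃ X : TangentSpace (𝓡 2) p, ∀ Y : TangentSpace (𝓡 2) p,
      metric f (φ p) (W - differential φ p X) (differential φ p Y) = 0 :=
    exists_tangential (V := TangentSpace (𝓡 2) p) f (φ p)
      (differential φ p).toLinearMap (h.pos p) W
  exact Classical.epsilon_spec (p := fun X : TangentSpace (𝓡 2) p =>
    ∀ Y : TangentSpace (𝓡 2) p,
      metric f (φ p) (W - differential φ p X) (differential φ p Y) = 0)
    h1 Y

theorem eq_tangentialPart {I : Set ℝ} {f : ℝ → ℝ} {φ : M → RW} (h : IsSpacelikeSurface I f φ)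
    (p : M) (W : RW) (X : TangentSpace (𝓡 2) p)
    (hX : ∀ Y : TangentSpace (𝓡 2) p,
      metric f (φ p) (W - differential φ p X) (differential φ p Y) = 0) :
    X = tangentialPart f φ p W := by
  by_contra hne
  have h1 := h.pos p (X - tangentialPart f φ p W) (sub_ne_zero.2 hne)
  have h2 := hX (X - tangentialPart f φ p W)
  have h3 := metric_normalPart h p W (X - tangentialPart f φ p W)
  have h4 : ∀ A B C D : RW, metric f (φ p) (A - B) D = 0 → metric f (φ p) (A - C) D = 0 →
      metric f (φ p) (B - C) D = 0 := by
    intro A B C D e1 e2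
    simp only [metric, Prod.fst_sub, Prod.snd_sub, inner_sub_left] at e1 e2 ⊢
    linarith
  have h5 := h4 _ _ _ _ h2 h3
  rw [← map_sub] at h5
  exact h1.ne' h5

/-- The induced covariant derivative `∇̃_X ξ` of a vector field `ξ` along `φ`, where `∇̃` is the
Levi-Civita connection of `L⁴₁(f,0)`. -/
def covDeriv (f : ℝ → ℝ) (φ ξ : M → RW) (p : M) (X : TangentSpace (𝓡 2) p) : RW :=
  differential ξ p X +
    christoffel f (φ p) (differential φ p X) (ξ p)

/-- The normal connection `∇^⊥_X ξ`. -/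
def normalCovDeriv (f : ℝ → ℝ) (φ ξ : M → RW) (p : M) (X : TangentSpace (𝓡 2) p) : RW :=
  normalPart f φ p (covDeriv f φ ξ p X)

/-- The comoving observer field `∂/∂t`. -/
def comoving : RW := (1, 0)

/-- The normal part `η` of `∂/∂t` along the surface. -/
def eta (f : ℝ → ℝ) (φ : M → RW) (p : M) : RW := normalPart f φ p comoving

/-- `η` is parallel in the normal bundle. -/
def HasParallelEta (f : ℝ → ℝ) (φ : M → RW) : Prop :=
  ∀ (p : M) (X : TangentSpace (𝓡 2) p), normalCovDeriv f φ (eta f φ) p X = 0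

/-- The isometry `(t, x) ↦ (t, A x)` of `L⁴₁(f,0)` given by a rigid motion `A` of `𝔼³`. -/
def rigidMotion (A : E3 ≃ᵃⁱ[ℝ] E3) (q : RW) : RW := (q.1, A q.2)

/-- Some neighbourhood of `p` in the surface `φ` is congruent, by a rigid motion of the factor
`𝔼³`, to a piece of the surface parameterized by `ψ` on `I × J`: there are smooth local
coordinates `(u, v)` of `M` around `p` in which the moved surface is given by `ψ(u, v)`. -/
def CongruentNear [IsManifold (𝓡 2) ∞ M] (I J : Set ℝ) (φ : M → RW) (p : M)
    (ψ : ℝ → ℝ → RW) : Prop :=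
  ∃ (A : E3 ≃ᵃⁱ[ℝ] E3) (e : OpenPartialHomeomorph M (EuclideanSpace ℝ (Fin 2))),
    e ∈ IsManifold.maximalAtlas (𝓡 2) ∞ M ∧ p ∈ e.source ∧
      ∀ q ∈ e.source, e q 0 ∈ I ∧ e q 1 ∈ J ∧ rigidMotion A (φ q) = ψ (e q 0) (e q 1)

/-- The surface `(u, c₁ ∫ dξ/f, c₂ ∫ dξ/f + c₃, v)`. -/
def cylinder (f : ℝ → ℝ) (u₀ c₁ c₂ c₃ u v : ℝ) : RW :=
  (u, !₂[c₁ * ∫ ξ in u₀..u, 1 / f ξ, c₂ * (∫ ξ in u₀..u, 1 / f ξ) + c₃, v])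

/-- `α` is a smooth curve in the unit sphere, parameterized by arc length on the open interval
`J`, with unit normal `n` (tangent to the sphere) and curvature `κ`: `α'' = κ n - α`. -/
structure IsSphericalCurve (J : Set ℝ) (α n : ℝ → E3) (κ : ℝ → ℝ) : Prop where
  isOpen : IsOpen J
  interval : J.OrdConnected
  smooth : ContDiffOn ℝ ∞ α J
  smooth_normal : ContDiffOn ℝ ∞ n J
  smooth_curvature : ContDiffOn ℝ ∞ κ J
  norm_eq : ∀ v ∈ J, ‖α v‖ = 1
  norm_deriv : ∀ v ∈ J, ‖deriv α v‖ = 1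
  norm_normal : ∀ v ∈ J, ‖n v‖ = 1
  inner_normal : ∀ v ∈ J, inner ℝ (n v) (α v) = 0
  inner_normal_deriv : ∀ v ∈ J, inner ℝ (n v) (deriv α v) = 0
  deriv_deriv : ∀ v ∈ J, deriv (deriv α) v = κ v • n v - α v

/-- The surface `(u, A₁ α + A₂ α' + A₃ n)` with
`A₂ = c sin τ(v) ∫ dξ/f + A₄(v)` and `A₃ = c cos τ(v) ∫ dξ/f + A₅(v)`. -/
def sphericalSurface (f : ℝ → ℝ) (u₀ c : ℝ) (α n : ℝ → E3) (τ A₁ A₄ A₅ : ℝ → ℝ)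
    (u v : ℝ) : RW :=
  (u, A₁ v • α v
    + (c * Real.sin (τ v) * (∫ ξ in u₀..u, 1 / f ξ) + A₄ v) • deriv α v
    + (c * Real.cos (τ v) * (∫ ξ in u₀..u, 1 / f ξ) + A₅ v) • n v)

/-- The conditions on the functions in `sphericalSurface`: they are smooth, and
`A₄' = κ A₅ - A₁`, `A₅' = -κ A₄`, `τ' = κ`. -/
structure IsSphericalData (J : Set ℝ) (κ τ A₁ A₄ A₅ : ℝ → ℝ) : Prop where
  smooth_τ : ContDiffOn ℝ ∞ τ J
  smooth_A₁ : ContDiffOn ℝ ∞ A₁ J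
  smooth_A₄ : ContDiffOn ℝ ∞ A₄ J
  smooth_A₅ : ContDiffOn ℝ ∞ A₅ J
  deriv_τ : ∀ v ∈ J, deriv τ v = κ v
  deriv_A₄ : ∀ v ∈ J, deriv A₄ v = κ v * A₅ v - A₁ v
  deriv_A₅ : ∀ v ∈ J, deriv A₅ v = -(κ v * A₄ v)

/-- Near `p` the surface is congruent to a cylinder of type (i). -/
def IsTypeOneNear [IsManifold (𝓡 2) ∞ M] (I : Set ℝ) (f : ℝ → ℝ) (φ : M → RW) (p : M) : Prop :=
  ∃ u₀ ∈ I, ∃ c₁ c₂ c₃ : ℝ, CongruentNear I Set.univ φ p (cylinder f u₀ c₁ c₂ c₃)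

/-- Near `p` the surface is congruent to a surface of type (ii). -/
def IsTypeTwoNear [IsManifold (𝓡 2) ∞ M] (I : Set ℝ) (f : ℝ → ℝ) (φ : M → RW) (p : M) : Prop :=
  ∃ u₀ ∈ I, ∃ (c : ℝ) (J : Set ℝ) (α n : ℝ → E3) (κ τ A₁ A₄ A₅ : ℝ → ℝ),
    IsSphericalCurve J α n κ ∧ IsSphericalData J κ τ A₁ A₄ A₅ ∧
      CongruentNear I J φ p (sphericalSurface f u₀ c α n τ A₁ A₄ A₅)

end RobertsonWalker

end

/-!
Surfaces with parallel `η` in a Robertson-Walker space-time.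

*Conformal reduction.* With the conformal time `s = ∫ dt / f` the metric is
`f² (-ds² + g₀)`, so the surface may be viewed in Minkowski space. Under this change the normal
spaces stay the same, and `η` is parallel if and only if the normal part `η'` of the constant field
`(1, 0)` is; as that field lives in a flat space, this says that the derivative of `η'` is tangent
to the surface (`normalCovDeriv_eta_eq_zero_iff`).

*Parallel fields give ruled surfaces.* Write `η' = (1 + c, b)`. If `η'` is parallel, then `c` is
constant (`eta_fst_eq`), since it is the square length of the tangential part `T` of `(1, 0)`; it is
positive because `dt ≠ 0` somewhere. The symmetry of the second fundamental form in the
direction `η'` shows that `b` is constant along `T` (`fderiv_etaFlat_tanFlat`), hence so are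
`w = b / c` and the foot point `y = x - s w`. Coordinates `(t, v)` with `v` a
linear function of `y` (`exists_adapted_chart`) therefore present the surface as
`x = s w(v) + y(v)`, where `|w|` is constant, `w ⟂ y'` and `w'` is a multiple of `y'`
(`exists_ruled_chart`).

*Normal forms.* Let `α` be the unit vector in the direction of `y'`. Where `α' ≠ 0`, parameterize
`α` by arc length. In its Frenet frame in the sphere the components of `w` along `α'` and `n` solve
`P' = κ Q`, `Q' = -κ P`, so they are `c sin τ` and `c cos τ` with `τ' = κ`, and the
components of `y` solve the system for `A₁`, `A₄`, `A₅` (`IsRuledData.exists_sphericalSurface`).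
Where `α` is locally constant, `w` is constant and `y` runs on a straight line, which gives the
cylinder (`IsRuledData.exists_cylinder`). The points of one of these two kinds form a dense open
set.

*Converse.* Both normal forms are ruled in the above sense, and for a ruled surface `η'` is computed
explicitly (`IsRuledData.isParallelAt`). That `η'` is parallel is a closed condition, so it extends
from a dense set to the whole surface (`hasParallelEta_of_dense`).
-/

noncomputable section
namespace RobertsonWalker

open Filter Topology

/-! ### Linear algebra of space-like planes in Minkowski space -/

/-- The coordinate plane, model space of surfaces. -/
abbrev Plane := EuclideanSpace ℝ (Fin 2)

/-- The Minkowski product on `ℝ × 𝔼³`. -/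
def mink (X Y : RW) : ℝ := -(X.1 * Y.1) + inner ℝ X.2 Y.2

theorem mink_comm (X Y : RW) : mink X Y = mink Y X := by
  simp only [mink, real_inner_comm, mul_comm]

theorem mink_sub_left (X X' Y : RW) : mink (X - X') Y = mink X Y - mink X' Y := by
  simp only [mink, Prod.fst_sub, Prod.snd_sub, inner_sub_left]; ring

theorem mink_add_left (X X' Y : RW) : mink (X + X') Y = mink X Y + mink X' Y := by
  simp only [mink, Prod.fst_add, Prod.snd_add, inner_add_left]; ring

theorem mink_smul_left (c : ℝ) (X Y : RW) : mink (c • X) Y = c * mink X Y := by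
  simp only [mink, Prod.smul_fst, Prod.smul_snd, inner_smul_left, smul_eq_mul]
  simp; ring

theorem mink_sub_right (X Y Y' : RW) : mink X (Y - Y') = mink X Y - mink X Y' := by
  rw [mink_comm, mink_sub_left, mink_comm Y, mink_comm Y']

theorem mink_add_right (X Y Y' : RW) : mink X (Y + Y') = mink X Y + mink X Y' := by
  rw [mink_comm, mink_add_left, mink_comm Y, mink_comm Y']

theorem mink_smul_right (c : ℝ) (X Y : RW) : mink X (c • Y) = c * mink X Y := by
  rw [mink_comm, mink_smul_left, mink_comm]

/-- A linear map from the plane to Minkowski space with space-like image; it is then injective. -/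
def IsSpacelikeMap (L : Plane →L[ℝ] RW) : Prop := ∀ X, X ≠ 0 → 0 < mink (L X) (L X)

/-- The first coordinate vector of the plane. -/
abbrev e₀ : Plane := EuclideanSpace.single 0 1

/-- The second coordinate vector of the plane. -/
abbrev e₁ : Plane := EuclideanSpace.single 1 1

theorem plane_eq (X : Plane) : X = X 0 • e₀ + X 1 • e₁ := by
  ext i; fin_cases i <;> simp [e₀, e₁]

theorem map_plane {F : Type*} [NormedAddCommGroup F] [NormedSpace ℝ F] (L : Plane →L[ℝ] F)
    (X : Plane) : L X = X 0 • L e₀ + X 1 • L e₁ := by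
  conv_lhs => rw [plane_eq X]
  simp only [map_add, map_smul]

/-- The Gram determinant of the image of the coordinate vectors. -/
def gramDet (L : Plane →L[ℝ] RW) : ℝ :=
  mink (L e₀) (L e₀) * mink (L e₁) (L e₁) - mink (L e₀) (L e₁) ^ 2

/-- The solution `X`, by Cramer's rule, of the equations saying that `W - L X` is orthogonal to the
image of `L`. The Gram determinant has to be nonzero, as it is for a space-like map. -/
def tanCoef (L : Plane →L[ℝ] RW) (W : RW) : Plane :=
  !₂[(mink W (L e₀) * mink (L e₁) (L e₁) - mink W (L e₁) * mink (L e₀) (L e₁)) / gramDet L,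
    (mink W (L e₁) * mink (L e₀) (L e₀) - mink W (L e₀) * mink (L e₀) (L e₁)) / gramDet L]

theorem e₀_ne_zero : e₀ ≠ 0 := fun h => by
  have := congrArg (fun X : Plane => X 0) h; simp [e₀] at this

theorem IsSpacelikeMap.gramDet_pos {L : Plane →L[ℝ] RW} (hL : IsSpacelikeMap L) :
    0 < gramDet L := by
  have h0 := hL e₀ e₀_ne_zero
  -- the vector `g₀₀ e₁ - g₀₁ e₀` has square length `g₀₀ (g₀₀ g₁₁ - g₀₁²)`
  set X : Plane := mink (L e₀) (L e₀) • e₁ - mink (L e₀) (L e₁) • e₀ with hX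
  have hX0 : X ≠ 0 := fun h => by
    have := congrArg (fun X : Plane => X 1) h
    simp [hX, e₀, e₁] at this
    exact h0.ne' this
  have h1 := hL X hX0
  have h2 : mink (L X) (L X) = mink (L e₀) (L e₀) * gramDet L := by
    simp only [hX, map_sub, map_smul, mink_sub_left, mink_sub_right, mink_smul_left,
      mink_smul_right, gramDet, mink_comm (L e₁) (L e₀)]
    ring
  rw [h2] at h1
  exact pos_of_mul_pos_right h1 h0.le

theorem IsSpacelikeMap.mink_sub_tanCoef {L : Plane →L[ℝ] RW} (hL : IsSpacelikeMap L) (W : RW)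
    (Y : Plane) : mink (W - L (tanCoef L W)) (L Y) = 0 := by
  have hd := hL.gramDet_pos.ne'
  rw [map_plane L Y, map_plane L (tanCoef L W)]
  simp only [mink_sub_left, mink_add_left, mink_add_right, mink_smul_left, mink_smul_right,
    tanCoef, mink_comm (L e₁) (L e₀)]
  simp
  field_simp
  simp only [gramDet]
  ring

theorem IsSpacelikeMap.eq_tanCoef {L : Plane →L[ℝ] RW} (hL : IsSpacelikeMap L) {W : RW}
    {X : Plane} (hX : ∀ Y, mink (W - L X) (L Y) = 0) : X = tanCoef L W := by
  by_contra hne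
  have h1 := hL (X - tanCoef L W) (sub_ne_zero.2 hne)
  have h2 := hX (X - tanCoef L W)
  have h3 := hL.mink_sub_tanCoef W (X - tanCoef L W)
  rw [mink_sub_left] at h2 h3
  conv at h1 => rw [map_sub L X]
  rw [map_sub] at h2 h3
  rw [mink_sub_left] at h1
  linarith

/-- On the range of `L` the map `tanCoef L` inverts `L`. -/
theorem IsSpacelikeMap.tanCoef_apply {L : Plane →L[ℝ] RW} (hL : IsSpacelikeMap L) (X : Plane) :
    tanCoef L (L X) = X := by
  refine (hL.eq_tanCoef fun Y => ?_).symm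
  simp [mink]

theorem contDiffOn_mink {E : Type*} [NormedAddCommGroup E] [NormedSpace ℝ E] {X Y : E → RW}
    {D : Set E} {k : WithTop ℕ∞} (hX : ContDiffOn ℝ k X D) (hY : ContDiffOn ℝ k Y D) :
    ContDiffOn ℝ k (fun z => mink (X z) (Y z)) D :=
  (hX.fst.mul hY.fst).neg.add (hX.snd.inner ℝ hY.snd)

theorem contDiffOn_fderiv_apply {F : Type*} [NormedAddCommGroup F] [NormedSpace ℝ F]
    {D : Set Plane} (hD : IsOpen D) {Ψ : Plane → F} (hΨ : ContDiffOn ℝ ∞ Ψ D) (X : Plane) :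
    ContDiffOn ℝ ∞ (fun z => fderiv ℝ Ψ z X) D :=
  (hΨ.fderiv_of_isOpen hD (by simp)).clm_apply contDiffOn_const

theorem contDiffOn_tanCoef {D : Set Plane} (hD : IsOpen D) {Ψ : Plane → RW}
    (hΨ : ContDiffOn ℝ ∞ Ψ D) (hs : ∀ z ∈ D, IsSpacelikeMap (fderiv ℝ Ψ z)) {W : Plane → RW}
    (hW : ContDiffOn ℝ ∞ W D) :
    ContDiffOn ℝ ∞ (fun z => tanCoef (fderiv ℝ Ψ z) (W z)) D := by
  have h0 := contDiffOn_fderiv_apply hD hΨ e₀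
  have h1 := contDiffOn_fderiv_apply hD hΨ e₁
  have h00 := contDiffOn_mink h0 h0
  have h01 := contDiffOn_mink h0 h1
  have h11 := contDiffOn_mink h1 h1
  have w0 := contDiffOn_mink hW h0
  have w1 := contDiffOn_mink hW h1
  have hg : ContDiffOn ℝ ∞ (fun z => gramDet (fderiv ℝ Ψ z)) D := (h00.mul h11).sub (h01.pow 2)
  have hg0 : ∀ z ∈ D, gramDet (fderiv ℝ Ψ z) ≠ 0 := fun z hz => (hs z hz).gramDet_pos.ne'
  refine contDiffOn_euclidean.2 fun i => ?_
  fin_cases i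
  · exact ((w0.mul h11).sub (w1.mul h01)).div hg hg0
  · exact ((w1.mul h00).sub (w0.mul h01)).div hg hg0

/-- The component of the constant time-like field `(1, 0)` of Minkowski space that is normal to
the surface `Ψ`. -/
def etaFlat (Ψ : Plane → RW) (z : Plane) : RW :=
  (1, 0) - fderiv ℝ Ψ z (tanCoef (fderiv ℝ Ψ z) (1, 0))

theorem contDiffOn_etaFlat {D : Set Plane} (hD : IsOpen D) {Ψ : Plane → RW}
    (hΨ : ContDiffOn ℝ ∞ Ψ D) (hs : ∀ z ∈ D, IsSpacelikeMap (fderiv ℝ Ψ z)) :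
    ContDiffOn ℝ ∞ (etaFlat Ψ) D :=
  contDiffOn_const.sub ((hΨ.fderiv_of_isOpen hD (by simp)).clm_apply
    (contDiffOn_tanCoef hD hΨ hs contDiffOn_const))

/-! ### Reduction to Minkowski space -/

section Reduction

variable {M : Type*} [TopologicalSpace M] [ChartedSpace (EuclideanSpace ℝ (Fin 2)) M]

/-- The differential of a chart at a point, with values in the coordinate plane. -/
def chartDeriv (e : OpenPartialHomeomorph M Plane) (p : M) :
    TangentSpace (𝓡 2) p →L[ℝ] Plane :=
  mfderiv (𝓡 2) (𝓡 2) e p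

theorem normalPart_eq_zero_iff {I : Set ℝ} {f : ℝ → ℝ} {φ : M → RW}
    (hφ : IsSpacelikeSurface I f φ) (p : M) (W : RW) :
    normalPart f φ p W = 0 ↔ ∃ X, W = differential φ p X := by
  constructor
  · intro h
    exact ⟨_, sub_eq_zero.1 h⟩
  · rintro ⟨X, rfl⟩
    rw [normalPart, ← eq_tangentialPart hφ p _ X, sub_self]
    intro Y
    simp [metric]

theorem contDiffOn_comp_symm {e : OpenPartialHomeomorph M Plane} {F : Type*}
    [NormedAddCommGroup F] [NormedSpace ℝ F] {ξ : M → F}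
    (hξ : ContMDiff (𝓡 2) 𝓘(ℝ, F) ∞ ξ) (he : e ∈ IsManifold.maximalAtlas (𝓡 2) ∞ M) :
    ContDiffOn ℝ ∞ (ξ ∘ e.symm) e.target :=
  (hξ.comp_contMDiffOn (contMDiffOn_symm_of_mem_maximalAtlas he)).contDiffOn

theorem mdifferentiable_of_mem_maximalAtlas [IsManifold (𝓡 2) ∞ M]
    {e : OpenPartialHomeomorph M Plane} (he : e ∈ IsManifold.maximalAtlas (𝓡 2) ∞ M) :
    e.MDifferentiable (𝓡 2) (𝓡 2) :=
  ⟨(contMDiffOn_of_mem_maximalAtlas he).mdifferentiableOn (by simp),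
    (contMDiffOn_symm_of_mem_maximalAtlas he).mdifferentiableOn (by simp)⟩

theorem chartDeriv_surjective [IsManifold (𝓡 2) ∞ M]
    {e : OpenPartialHomeomorph M Plane} (he : e ∈ IsManifold.maximalAtlas (𝓡 2) ∞ M) {p : M}
    (hp : p ∈ e.source) : Function.Surjective (chartDeriv e p) :=
  (mdifferentiable_of_mem_maximalAtlas he).mfderiv_surjective hp

theorem mfderiv_apply_eq_fderiv_chartDeriv [IsManifold (𝓡 2) ∞ M]
    {F : Type*} [NormedAddCommGroup F] [NormedSpace ℝ F]
    {e : OpenPartialHomeomorph M Plane} (he : e ∈ IsManifold.maximalAtlas (𝓡 2) ∞ M) {p : M}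
    (hp : p ∈ e.source) {ξ : M → F} (hξ : DifferentiableAt ℝ (ξ ∘ e.symm) (e p))
    (X : TangentSpace (𝓡 2) p) :
    mfderiv (𝓡 2) 𝓘(ℝ, F) ξ p X = fderiv ℝ (ξ ∘ e.symm) (e p) (chartDeriv e p X) := by
  have h1 : ξ =ᶠ[𝓝 p] (ξ ∘ e.symm) ∘ e := by
    filter_upwards [e.open_source.mem_nhds hp] with q hq
    simp [e.left_inv hq]
  rw [h1.mfderiv_eq, mfderiv_comp p hξ.mdifferentiableAt
    ((mdifferentiable_of_mem_maximalAtlas he).mdifferentiableAt hp), mfderiv_eq_fderiv]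
  rfl

theorem differential_apply_eq [IsManifold (𝓡 2) ∞ M]
    {e : OpenPartialHomeomorph M Plane} (he : e ∈ IsManifold.maximalAtlas (𝓡 2) ∞ M) {z : Plane}
    (hz : z ∈ e.target) {ξ : M → RW} (hξ : DifferentiableAt ℝ (ξ ∘ e.symm) z)
    (X : TangentSpace (𝓡 2) (e.symm z)) :
    differential ξ (e.symm z) X = fderiv ℝ (ξ ∘ e.symm) z (chartDeriv e (e.symm z) X) := by
  have h := mfderiv_apply_eq_fderiv_chartDeriv he (e.map_target hz) (ξ := ξ)
    (by rwa [e.right_inv hz]) X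
  rwa [e.right_inv hz] at h

/-- The coordinate expression of the surface `φ`, with `t` replaced by the conformal time `S t`.
When `S' = 1 / f` this is a surface in Minkowski space. -/
def flatten (S : ℝ → ℝ) (φ : M → RW) (e : OpenPartialHomeomorph M Plane) (z : Plane) : RW :=
  (S (φ (e.symm z)).1, (φ (e.symm z)).2)

/-- `S` is a smooth primitive of `1 / f` on `I`: a conformal time. -/
structure IsConformalTime (I : Set ℝ) (f S : ℝ → ℝ) : Prop where
  smooth : ContDiffOn ℝ ∞ S I
  hasDerivAt : ∀ u ∈ I, HasDerivAt S (1 / f u) u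

variable {I : Set ℝ} {f S : ℝ → ℝ} {φ : M → RW} {e : OpenPartialHomeomorph M Plane}

theorem contDiffOn_flatten (hφ : IsSpacelikeSurface I f φ)
    (he : e ∈ IsManifold.maximalAtlas (𝓡 2) ∞ M) (hS : IsConformalTime I f S) :
    ContDiffOn ℝ ∞ (flatten S φ e) e.target := by
  have h := contDiffOn_comp_symm hφ.smooth he
  exact (hS.smooth.comp h.fst fun z _ => hφ.mem _).prodMk h.snd

theorem fderiv_flatten (hφ : IsSpacelikeSurface I f φ)
    (he : e ∈ IsManifold.maximalAtlas (𝓡 2) ∞ M) (hS : IsConformalTime I f S) {z : Plane}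
    (hz : z ∈ e.target) (X : Plane) :
    fderiv ℝ (flatten S φ e) z X = ((fderiv ℝ (φ ∘ e.symm) z X).1 / f (φ (e.symm z)).1,
      (fderiv ℝ (φ ∘ e.symm) z X).2) := by
  have h : HasFDerivAt (φ ∘ e.symm) (fderiv ℝ (φ ∘ e.symm) z) z :=
    (((contDiffOn_comp_symm hφ.smooth he).contDiffAt
      (e.open_target.mem_nhds hz)).differentiableAt (by simp)).hasFDerivAt
  have h1 := (hS.hasDerivAt _ (hφ.mem (e.symm z))).comp_hasFDerivAt z h.fst
  have h2 : HasFDerivAt (flatten S φ e) _ z := h1.prodMk h.snd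
  rw [h2.fderiv]
  ext <;> simp [div_eq_inv_mul]

variable [IsManifold (𝓡 2) ∞ M]

theorem differential_eq (hφ : IsSpacelikeSurface I f φ)
    (he : e ∈ IsManifold.maximalAtlas (𝓡 2) ∞ M) (hS : IsConformalTime I f S) {z : Plane}
    (hz : z ∈ e.target) (h0 : f (φ (e.symm z)).1 ≠ 0) (X : TangentSpace (𝓡 2) (e.symm z)) :
    differential φ (e.symm z) X =
      (f (φ (e.symm z)).1 * (fderiv ℝ (flatten S φ e) z (chartDeriv e (e.symm z) X)).1,
        (fderiv ℝ (flatten S φ e) z (chartDeriv e (e.symm z) X)).2) := by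
  have h : DifferentiableAt ℝ (φ ∘ e.symm) z :=
    ((contDiffOn_comp_symm hφ.smooth he).contDiffAt
      (e.open_target.mem_nhds hz)).differentiableAt (by simp)
  rw [differential_apply_eq he hz h, fderiv_flatten hφ he hS hz]
  ext1
  · simp only; field_simp
  · rfl

/-- The Robertson-Walker metric is conformal to the Minkowski metric in conformal time. -/
theorem metric_eq_mink {q : RW} (h0 : f q.1 ≠ 0) (X Y : RW) :
    metric f q (f q.1 * X.1, X.2) Y = f q.1 ^ 2 * mink X (Y.1 / f q.1, Y.2) := by
  simp only [metric, mink]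
  field_simp

theorem isSpacelikeMap_flatten (hφ : IsSpacelikeSurface I f φ)
    (he : e ∈ IsManifold.maximalAtlas (𝓡 2) ∞ M) (hS : IsConformalTime I f S)
    (hf0 : ∀ t ∈ I, f t ≠ 0) {z : Plane} (hz : z ∈ e.target) :
    IsSpacelikeMap (fderiv ℝ (flatten S φ e) z) := by
  intro X hX
  obtain ⟨Y, rfl⟩ := chartDeriv_surjective he (e.map_target hz) X
  have h0 := hf0 _ (hφ.mem (e.symm z))
  have hY : Y ≠ 0 := fun h => hX (by rw [h, map_zero])
  have h1 := hφ.pos _ Y hY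
  rw [differential_eq hφ he hS hz h0, metric_eq_mink h0] at h1
  simp only [mul_div_cancel_left₀ _ h0] at h1
  exact pos_of_mul_pos_right h1 (sq_nonneg _)

/-- In conformal time the normal part of `∂/∂t` is `1 / f` times that of the Minkowski field. -/
theorem eta_eq (hφ : IsSpacelikeSurface I f φ)
    (he : e ∈ IsManifold.maximalAtlas (𝓡 2) ∞ M) (hS : IsConformalTime I f S)
    (hf0 : ∀ t ∈ I, f t ≠ 0) {z : Plane} (hz : z ∈ e.target) :
    eta f φ (e.symm z) = ((etaFlat (flatten S φ e) z).1,
      (f (φ (e.symm z)).1)⁻¹ • (etaFlat (flatten S φ e) z).2) := by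
  have h0 := hf0 _ (hφ.mem (e.symm z))
  set a := f (φ (e.symm z)).1 with ha
  obtain ⟨X, hX⟩ := chartDeriv_surjective he (e.map_target hz)
    (a⁻¹ • tanCoef (fderiv ℝ (flatten S φ e) z) (1, 0))
  have key : comoving - differential φ (e.symm z) X = ((etaFlat (flatten S φ e) z).1,
      a⁻¹ • (etaFlat (flatten S φ e) z).2) := by
    rw [differential_eq hφ he hS hz h0, hX, ← ha]
    simp only [etaFlat, comoving, map_smul]
    ext1
    · simp [mul_inv_cancel_left₀ h0]
    · simp
  rw [eta, normalPart, ← eq_tangentialPart hφ _ _ X, key]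
  intro Y
  have h1 := (isSpacelikeMap_flatten hφ he hS hf0 hz).mink_sub_tanCoef (1, 0)
    (chartDeriv e (e.symm z) Y)
  rw [key, differential_eq hφ he hS hz h0]
  simp only [metric, mink, etaFlat, ← ha, inner_smul_left] at h1 ⊢
  simp only [map_inv₀, Real.ringHom_apply]
  field_simp
  linear_combination a * h1

/-- Conformal invariance: `η` is parallel at a point exactly when the derivative of the normal
part of the constant field of Minkowski space is tangent to the flattened surface there. -/
theorem normalCovDeriv_eta_eq_zero_iff (hφ : IsSpacelikeSurface I f φ)
    (he : e ∈ IsManifold.maximalAtlas (𝓡 2) ∞ M) (hS : IsConformalTime I f S)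
    (hI : IsOpen I) (hf : ContDiffOn ℝ ∞ f I) (hf0 : ∀ t ∈ I, f t ≠ 0) {z : Plane}
    (hz : z ∈ e.target) :
    (∀ X, normalCovDeriv f φ (eta f φ) (e.symm z) X = 0) ↔
      ∀ X, ∃ Y, fderiv ℝ (etaFlat (flatten S φ e)) z X = fderiv ℝ (flatten S φ e) z Y := by
  have hzp := e.map_target hz
  have h0 := hf0 _ (hφ.mem (e.symm z))
  have hL := fun Y => differential_eq hφ he hS hz h0 Y
  set t := (φ (e.symm z)).1 with ht
  have hsp := fun z hz => isSpacelikeMap_flatten (z := z) hφ he hS hf0 hz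
  have hη : HasFDerivAt (etaFlat (flatten S φ e)) (fderiv ℝ (etaFlat (flatten S φ e)) z) z :=
    (((contDiffOn_etaFlat e.open_target (contDiffOn_flatten hφ he hS) hsp).contDiffAt
      (e.open_target.mem_nhds hz)).differentiableAt (by simp)).hasFDerivAt
  have hψ : HasFDerivAt (φ ∘ e.symm) (fderiv ℝ (φ ∘ e.symm) z) z :=
    (((contDiffOn_comp_symm hφ.smooth he).contDiffAt
      (e.open_target.mem_nhds hz)).differentiableAt (by simp)).hasFDerivAt
  have hft : HasDerivAt f (deriv f t) t :=
    (((hf.contDiffAt (hI.mem_nhds (hφ.mem _))).differentiableAt (by simp))).hasDerivAt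
  have h1 := (hft.inv h0).comp_hasFDerivAt z hψ.fst
  have h2 := hη.fst.prodMk (h1.smul hη.snd)
  have h3 := h2.congr_of_eventuallyEq (f₁ := eta f φ ∘ e.symm) (by
    filter_upwards [e.open_target.mem_nhds hz] with z' hz'
    exact eta_eq hφ he hS hf0 hz')
  -- the covariant derivative of `η`, in terms of the derivative of the flat normal field
  have key : ∀ X : TangentSpace (𝓡 2) (e.symm z),
      covDeriv f φ (eta f φ) (e.symm z) X =
      let H := fderiv ℝ (etaFlat (flatten S φ e)) z (chartDeriv e (e.symm z) X) +
        (deriv f t * (etaFlat (flatten S φ e) z).1) •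
          fderiv ℝ (flatten S φ e) z (chartDeriv e (e.symm z) X)
      (H.1, (f t)⁻¹ • H.2) := by
    intro X
    have hn := (hsp z hz).mink_sub_tanCoef (1, 0) (chartDeriv e (e.symm z) X)
    have hd := fderiv_flatten hφ he hS hz (chartDeriv e (e.symm z) X)
    rw [← ht] at hd
    rw [covDeriv, hL, eta_eq hφ he hS hf0 hz,
      differential_apply_eq he hz h3.differentiableAt, h3.fderiv]
    rw [show (1, 0) - fderiv ℝ (flatten S φ e) z (tanCoef (fderiv ℝ (flatten S φ e) z) (1, 0))
      = etaFlat (flatten S φ e) z from rfl] at hn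
    have hd1 : (fderiv ℝ (φ ∘ e.symm) z (chartDeriv e (e.symm z) X)).1 =
        f t * (fderiv ℝ (flatten S φ e) z (chartDeriv e (e.symm z) X)).1 := by
      rw [hd]; field_simp
    simp only [mink] at hn
    rw [real_inner_comm] at hn
    ext1
    · simp only [christoffel, ← ht, inner_smul_right, Prod.fst_add, Prod.smul_fst, smul_eq_mul]
      simp
      field_simp
      linear_combination (deriv f t) * hn
    · simp only [christoffel, ← ht]
      simp [hd1]
      rw [← ht]
      match_scalars <;> field_simp
      ring
  simp only [normalCovDeriv, normalPart_eq_zero_iff hφ, key, hL]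
  constructor
  · intro h X
    obtain ⟨X', rfl⟩ := chartDeriv_surjective he hzp X
    obtain ⟨Y, hY⟩ := h X'
    refine ⟨f t • chartDeriv e (e.symm z) Y - (deriv f t * (etaFlat (flatten S φ e) z).1) •
      chartDeriv e (e.symm z) X', ?_⟩
    rw [Prod.ext_iff] at hY
    rw [map_sub, map_smul, map_smul, eq_sub_iff_add_eq]
    ext1
    · exact hY.1
    · have := congrArg (f t • ·) hY.2
      simpa [smul_smul, h0] using this
  · intro h X
    obtain ⟨Y, hY⟩ := h (chartDeriv e (e.symm z) X)
    obtain ⟨Y', hY'⟩ := chartDeriv_surjective he hzp ((f t)⁻¹ • (Y +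
      (deriv f t * (etaFlat (flatten S φ e) z).1) • chartDeriv e (e.symm z) X))
    refine ⟨Y', ?_⟩
    rw [hY', hY, ← map_smul, ← map_add, map_smul]
    ext1
    · simp
      field_simp
    · simp

end Reduction

/-! ### Charts of surfaces -/

section Charts

variable {M : Type*} [TopologicalSpace M] [ChartedSpace (EuclideanSpace ℝ (Fin 2)) M]

/-- Inverse function theorem, for new coordinates on a surface: a smooth function `G` of the
coordinates `e` with invertible derivative at a point gives a chart in the maximal atlas. -/
theorem exists_chart_comp [IsManifold (𝓡 2) ∞ M] {e : OpenPartialHomeomorph M Plane}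
    (he : e ∈ IsManifold.maximalAtlas (𝓡 2) ∞ M) {p : M} (hp : p ∈ e.source) {W : Set M}
    (hW : W ∈ 𝓝 p) {D : Set Plane} (hD : IsOpen D) (hpD : e p ∈ D) {G : Plane → Plane}
    (hG : ContDiffOn ℝ ∞ G D) (hs : Function.Surjective (fderiv ℝ G (e p))) :
    ∃ e' ∈ IsManifold.maximalAtlas (𝓡 2) ∞ M, p ∈ e'.source ∧ e'.source ⊆ W ∩ e.source ∧
      ∀ q ∈ e'.source, e' q = G (e q) := by
  have hsm : ∀ z ∈ D, ContDiffAt ℝ ∞ G z := fun z hz => hG.contDiffAt (hD.mem_nhds hz)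
  have hder : ∀ z ∈ D, HasFDerivAt G (fderiv ℝ G z) z := fun z hz =>
    ((hsm z hz).differentiableAt (by simp)).hasFDerivAt
  have hinj : Function.Injective (fderiv ℝ G (e p)) :=
    (LinearMap.injective_iff_surjective (f := (fderiv ℝ G (e p)).toLinearMap)).2 hs
  let L : Plane ≃L[ℝ] Plane := (LinearEquiv.ofBijective (fderiv ℝ G (e p)).toLinearMap
    ⟨hinj, hs⟩).toContinuousLinearEquiv
  have hL : (L : Plane →L[ℝ] Plane) = fderiv ℝ G (e p) := by ext1 z; rfl
  have hGL : HasFDerivAt G (L : Plane →L[ℝ] Plane) (e p) := by rw [hL]; exact hder _ hpD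
  let g := (hsm _ hpD).toOpenPartialHomeomorph G hGL (by simp)
  have hpg : e p ∈ g.source := (hsm _ hpD).mem_toOpenPartialHomeomorph_source hGL (by simp)
  -- the open set of points of `D` at which the derivative of `G` is still invertible
  let D' : Set Plane := D ∩ fderiv ℝ G ⁻¹'
    Set.range ((↑) : (Plane ≃L[ℝ] Plane) → Plane →L[ℝ] Plane)
  have hD' : IsOpen D' := (hG.continuousOn_fderiv_of_isOpen hD (by simp)).isOpen_inter_preimage hD
    ContinuousLinearEquiv.isOpen
  have hpD' : e p ∈ D' := ⟨hpD, L, hL⟩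
  let O : Set M := interior W ∩ (e.source ∩ e ⁻¹' D')
  have hO : IsOpen O := isOpen_interior.inter (e.isOpen_inter_preimage hD')
  have hpO : p ∈ O := ⟨mem_interior_iff_mem_nhds.2 hW, hp, hpD'⟩
  let e' := (e.trans g).restr O
  have hsrc : ∀ q ∈ e'.source, q ∈ O ∧ e q ∈ g.source := by
    intro q hq
    rw [OpenPartialHomeomorph.restr_source' _ _ hO] at hq
    exact ⟨hq.2, hq.1.2⟩
  have htgt : ∀ z ∈ e'.target, z ∈ g.target ∧ g.symm z ∈ e.target ∧ g.symm z ∈ D' := by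
    intro z hz
    have h1 := (hsrc _ (e'.map_target hz)).1
    have h2 : z ∈ (e.trans g).target := hz.1
    rw [OpenPartialHomeomorph.trans_target] at h2
    refine ⟨h2.1, h2.2, ?_⟩
    have h3 : e (e.symm (g.symm z)) ∈ D' := h1.2.2
    rwa [e.right_inv h2.2] at h3
  refine ⟨e', (IsManifold.mem_maximalAtlas_iff_contMDiffOn e').2 ⟨?_, ?_⟩, ?_, ?_, fun q hq => rfl⟩
  · have h1 : ContMDiffOn (𝓡 2) (𝓡 2) ∞ G D := hG.contMDiffOn
    exact h1.comp ((contMDiffOn_of_mem_maximalAtlas he).mono fun q hq => (hsrc q hq).1.2.1)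
      fun q hq => (hsrc q hq).1.2.2.1
  · have h1 : ContMDiffOn (𝓡 2) (𝓡 2) ∞ g.symm e'.target := by
      refine ContDiffOn.contMDiffOn fun z hz => ContDiffAt.contDiffWithinAt ?_
      obtain ⟨hz1, hz2, hz3, L', hL'⟩ := htgt z hz
      exact g.contDiffAt_symm (f₀' := L') hz1 (by rw [hL']; exact hder _ hz3) (hsm _ hz3)
    exact (contMDiffOn_symm_of_mem_maximalAtlas he).comp h1 fun z hz => (htgt z hz).2.1
  · rw [OpenPartialHomeomorph.restr_source' _ _ hO]
    exact ⟨⟨hp, hpg⟩, hpO⟩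
  · intro q hq
    have h := (hsrc q hq).1
    exact ⟨interior_subset h.1, h.2.1⟩

/-- A chart may be shrunk to any open part of its target. -/
theorem exists_chart_target_eq {e : OpenPartialHomeomorph M Plane}
    (he : e ∈ IsManifold.maximalAtlas (𝓡 2) ∞ M) {R : Set Plane} (hR : IsOpen R)
    (hRe : R ⊆ e.target) :
    ∃ e' ∈ IsManifold.maximalAtlas (𝓡 2) ∞ M, e'.target = R ∧ e'.source = e.source ∩ e ⁻¹' R ∧
      (e' : M → Plane) = e := by
  have hO := e.isOpen_inter_preimage hR
  refine ⟨e.restr (e.source ∩ e ⁻¹' R), restr_mem_maximalAtlas (contDiffGroupoid ∞ (𝓡 2)) he hO,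
    ?_, ?_, rfl⟩
  · ext z
    constructor
    · rintro ⟨h1, h2⟩
      have h3 := interior_subset h2
      have h4 : e (e.symm z) ∈ R := h3.2
      rwa [e.right_inv h1] at h4
    · intro hz
      refine ⟨hRe hz, ?_⟩
      change e.symm z ∈ interior _
      rw [hO.interior_eq]
      exact ⟨e.map_target (hRe hz), by rwa [Set.mem_preimage, e.right_inv (hRe hz)]⟩
  · rw [OpenPartialHomeomorph.restr_source' _ _ hO]
    ext q; simp

/-- The product of two sets of real numbers, as a set of points of the coordinate plane. -/
def rectangle (A B : Set ℝ) : Set Plane := {z | z 0 ∈ A ∧ z 1 ∈ B}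

theorem isOpen_rectangle {A B : Set ℝ} (hA : IsOpen A) (hB : IsOpen B) :
    IsOpen (rectangle A B) :=
  (hA.preimage (by fun_prop : Continuous fun z : Plane => z 0)).inter
    (hB.preimage (by fun_prop : Continuous fun z : Plane => z 1))

theorem exists_rectangle_subset {D : Set Plane} (hD : IsOpen D) {z : Plane} (hz : z ∈ D) :
    ∃ δ > 0, rectangle (Metric.ball (z 0) δ) (Metric.ball (z 1) δ) ⊆ D := by
  have h := (EuclideanSpace.equiv (Fin 2) ℝ).symm.continuous.isOpen_preimage D hD
  obtain ⟨δ, hδ, h1⟩ := Metric.isOpen_iff.1 h (EuclideanSpace.equiv (Fin 2) ℝ z) (by simpa using hz)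
  refine ⟨δ, hδ, fun w hw => ?_⟩
  have h2 := h1 (a := EuclideanSpace.equiv (Fin 2) ℝ w) (by
    rw [Metric.mem_ball, dist_pi_lt_iff hδ]
    intro i
    fin_cases i
    · exact hw.1
    · exact hw.2)
  simpa using h2

end Charts

/-! ### Surfaces of Minkowski space with parallel normal field -/

section FlatParallel

variable {D : Set Plane} {Ψ : Plane → RW} {z : Plane}

theorem mink_fderiv_add_eq_zero {A B : Plane → RW} (hA : DifferentiableAt ℝ A z)
    (hB : DifferentiableAt ℝ B z) (h : ∀ᶠ y in 𝓝 z, mink (A y) (B y) = 0) (X : Plane) :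
    mink (fderiv ℝ A z X) (B z) + mink (A z) (fderiv ℝ B z X) = 0 := by
  have h1 := (hA.hasFDerivAt.fst.mul hB.hasFDerivAt.fst).neg.add
    (hA.hasFDerivAt.snd.inner ℝ hB.hasFDerivAt.snd)
  have h2 := h1.congr_of_eventuallyEq (f₁ := fun _ => (0 : ℝ)) (by
    filter_upwards [h] with y hy
    exact hy.symm)
  have h3 := h2.unique (hasFDerivAt_const (0 : ℝ) z)
  have h4 := congrArg (fun L : Plane →L[ℝ] ℝ => L X) h3
  simp at h4
  simp only [mink]
  linarith

/-- A space-like surface of Minkowski space parameterized on the open set `D`. -/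
structure IsFlatSurface (D : Set Plane) (Ψ : Plane → RW) : Prop where
  isOpen : IsOpen D
  smooth : ContDiffOn ℝ ∞ Ψ D
  spacelike : ∀ z ∈ D, IsSpacelikeMap (fderiv ℝ Ψ z)

/-- The derivative of the normal part of the constant field `(1, 0)` is tangent to `Ψ` at `z`. -/
def IsParallelAt (Ψ : Plane → RW) (z : Plane) : Prop :=
  ∀ X, ∃ Y, fderiv ℝ (etaFlat Ψ) z X = fderiv ℝ Ψ z Y

/-- The coordinates of the tangential part of the constant field `(1, 0)`. -/
def tanFlat (Ψ : Plane → RW) (z : Plane) : Plane := tanCoef (fderiv ℝ Ψ z) (1, 0)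

theorem fderiv_tanFlat : fderiv ℝ Ψ z (tanFlat Ψ z) = (1, 0) - etaFlat Ψ z := by
  simp [etaFlat, tanFlat]

namespace IsFlatSurface

variable (h : IsFlatSurface D Ψ)
include h

theorem mink_etaFlat (hz : z ∈ D) (X : Plane) : mink (etaFlat Ψ z) (fderiv ℝ Ψ z X) = 0 :=
  (h.spacelike z hz).mink_sub_tanCoef _ X

theorem smooth_etaFlat : ContDiffOn ℝ ∞ (etaFlat Ψ) D :=
  contDiffOn_etaFlat h.isOpen h.smooth h.spacelike

theorem differentiableAt_etaFlat (hz : z ∈ D) : DifferentiableAt ℝ (etaFlat Ψ) z :=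
  (h.smooth_etaFlat.contDiffAt (h.isOpen.mem_nhds hz)).differentiableAt (by simp)

theorem mink_etaFlat_self (hz : z ∈ D) : mink (etaFlat Ψ z) (etaFlat Ψ z - (1, 0)) = 0 := by
  have h1 := h.mink_etaFlat hz (tanFlat Ψ z)
  rw [fderiv_tanFlat, mink_sub_right] at h1
  rw [mink_sub_right]
  linarith

theorem norm_etaFlat_snd (hz : z ∈ D) :
    ‖(etaFlat Ψ z).2‖ ^ 2 = (etaFlat Ψ z).1 * ((etaFlat Ψ z).1 - 1) := by
  have h1 := h.mink_etaFlat_self hz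
  simp only [mink, Prod.fst_sub, Prod.snd_sub, sub_zero, real_inner_self_eq_norm_sq] at h1
  linarith

theorem mink_fderiv_etaFlat_self (hz : z ∈ D) (hp : IsParallelAt Ψ z) (X : Plane) :
    mink (fderiv ℝ (etaFlat Ψ) z X) (etaFlat Ψ z) = 0 := by
  obtain ⟨Y, hY⟩ := hp X
  rw [hY, mink_comm, h.mink_etaFlat hz]

/-- If `η` is parallel, its time component is constant. -/
theorem fderiv_etaFlat_fst (hz : z ∈ D) (hp : IsParallelAt Ψ z) (X : Plane) :
    (fderiv ℝ (etaFlat Ψ) z X).1 = 0 := by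
  have hd := h.differentiableAt_etaFlat hz
  have h1 := mink_fderiv_add_eq_zero hd (hd.sub_const (1, 0)) (by
    filter_upwards [h.isOpen.mem_nhds hz] with y hy
    exact h.mink_etaFlat_self hy) X
  have h2 := h.mink_fderiv_etaFlat_self hz hp X
  rw [fderiv_sub_const, mink_sub_right, mink_comm (etaFlat Ψ z), h2] at h1
  simpa [mink] using h1

/-- Symmetry of the second fundamental form in the direction of the normal part of `(1, 0)`. -/
theorem mink_fderiv_etaFlat_comm (hz : z ∈ D) (X Y : Plane) :
    mink (fderiv ℝ (etaFlat Ψ) z X) (fderiv ℝ Ψ z Y) =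
      mink (fderiv ℝ (etaFlat Ψ) z Y) (fderiv ℝ Ψ z X) := by
  have hc := h.smooth.contDiffAt (h.isOpen.mem_nhds hz)
  have hd : DifferentiableAt ℝ (fderiv ℝ Ψ) z :=
    ((h.smooth.fderiv_of_isOpen (m := ∞) h.isOpen (by simp)).contDiffAt
      (h.isOpen.mem_nhds hz)).differentiableAt (by simp)
  have key : ∀ X Y, mink (fderiv ℝ (etaFlat Ψ) z X) (fderiv ℝ Ψ z Y) +
      mink (etaFlat Ψ z) (fderiv ℝ (fderiv ℝ Ψ) z X Y) = 0 := by
    intro X Y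
    have h1 := mink_fderiv_add_eq_zero (h.differentiableAt_etaFlat hz)
      (hd.clm_apply (differentiableAt_const Y)) (by
      filter_upwards [h.isOpen.mem_nhds hz] with y hy
      exact h.mink_etaFlat hy Y) X
    rw [fderiv_clm_apply hd (differentiableAt_const Y)] at h1
    simpa using h1
  have hsymm : fderiv ℝ (fderiv ℝ Ψ) z X Y = fderiv ℝ (fderiv ℝ Ψ) z Y X :=
    (hc.isSymmSndFDerivAt (by simpa using ENat.LEInfty.out)).eq X Y
  have h1 := key X Y
  have h2 := key Y X
  rw [hsymm] at h1
  linarith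

/-- If `η` is parallel, it is constant along the integral curves of the tangential part of
`(1, 0)`, which therefore are straight lines. -/
theorem fderiv_etaFlat_tanFlat (hz : z ∈ D) (hp : IsParallelAt Ψ z) :
    fderiv ℝ (etaFlat Ψ) z (tanFlat Ψ z) = 0 := by
  have h1 : ∀ X, mink (fderiv ℝ (etaFlat Ψ) z (tanFlat Ψ z)) (fderiv ℝ Ψ z X) = 0 := by
    intro X
    rw [h.mink_fderiv_etaFlat_comm hz, fderiv_tanFlat, mink_sub_right,
      h.mink_fderiv_etaFlat_self hz hp]
    simp [mink, h.fderiv_etaFlat_fst hz hp]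
  obtain ⟨Y, hY⟩ := hp (tanFlat Ψ z)
  rw [hY] at h1 ⊢
  by_contra hne
  have hY0 : Y ≠ 0 := fun h0 => hne (by rw [h0, map_zero])
  exact (h.spacelike z hz Y hY0).ne' (h1 Y)

theorem mink_tanFlat (hz : z ∈ D) :
    mink (fderiv ℝ Ψ z (tanFlat Ψ z)) (fderiv ℝ Ψ z (tanFlat Ψ z)) = (etaFlat Ψ z).1 - 1 := by
  rw [fderiv_tanFlat]
  have h1 := h.norm_etaFlat_snd hz
  simp only [mink, Prod.fst_sub, Prod.snd_sub, zero_sub, inner_neg_left, inner_neg_right, neg_neg,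
    real_inner_self_eq_norm_sq, h1]
  ring

/-- The time component of `η` exceeds `1` unless the time function is critical. -/
theorem one_lt_etaFlat_fst (hz : z ∈ D) {X : Plane} (hX : (fderiv ℝ Ψ z X).1 ≠ 0) :
    1 < (etaFlat Ψ z).1 := by
  by_cases h0 : tanFlat Ψ z = 0
  · have h1 := h.mink_etaFlat hz X
    have h2 := fderiv_tanFlat (Ψ := Ψ) (z := z)
    rw [h0, map_zero, eq_comm, sub_eq_zero] at h2
    rw [← h2] at h1
    simp [mink] at h1
    exact absurd h1 hX
  · have h1 := h.spacelike z hz _ h0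
    rw [h.mink_tanFlat hz] at h1
    linarith

/-- The points where the flat normal field is parallel form a relatively closed set. -/
theorem isParallelAt_of_mem_closure {s : Set Plane} (hs : ∀ y ∈ s ∩ D, IsParallelAt Ψ y)
    (hz : z ∈ D) (hzs : z ∈ closure (s ∩ D)) : IsParallelAt Ψ z := by
  intro X
  have hη := contDiffOn_fderiv_apply h.isOpen h.smooth_etaFlat X
  have hc : ContDiffOn ℝ ∞ (fun y => fderiv ℝ (etaFlat Ψ) y X -
      fderiv ℝ Ψ y (tanCoef (fderiv ℝ Ψ y) (fderiv ℝ (etaFlat Ψ) y X))) D :=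
    hη.sub ((h.smooth.fderiv_of_isOpen h.isOpen (by simp)).clm_apply
      (contDiffOn_tanCoef h.isOpen h.smooth h.spacelike hη))
  refine ⟨tanCoef (fderiv ℝ Ψ z) (fderiv ℝ (etaFlat Ψ) z X), sub_eq_zero.1 ?_⟩
  have h1 := (hc.continuousOn z hz).mono (Set.inter_subset_right (s := s))
  have h2 := h1.mem_closure_image hzs
  have h3 : (fun y => fderiv ℝ (etaFlat Ψ) y X -
      fderiv ℝ Ψ y (tanCoef (fderiv ℝ Ψ y) (fderiv ℝ (etaFlat Ψ) y X))) '' (s ∩ D) ⊆ {0} := by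
    rintro _ ⟨y, hy, rfl⟩
    obtain ⟨Y, hY⟩ := hs y hy X
    simp only [hY, (h.spacelike y hy.2).tanCoef_apply, sub_self, Set.mem_singleton_iff]
  simpa using closure_mono h3 h2

end IsFlatSurface

end FlatParallel

/-! ### Curves in Euclidean space -/

section Curves

theorem hasDerivAt_primitive {J : Set ℝ} (hJ : IsOpen J) (hJ' : J.OrdConnected) {g : ℝ → ℝ}
    (hg : ContinuousOn g J) {v₀ v : ℝ} (h0 : v₀ ∈ J) (hv : v ∈ J) :
    HasDerivAt (fun u => ∫ ξ in v₀..u, g ξ) (g v) v :=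
  intervalIntegral.integral_hasDerivAt_right
    ((hg.mono (hJ'.uIcc_subset h0 hv)).intervalIntegrable)
    (hg.stronglyMeasurableAtFilter hJ v hv) (hg.continuousAt (hJ.mem_nhds hv))

theorem contDiffOn_infty_of_hasDerivAt {F : Type*} [NormedAddCommGroup F] [NormedSpace ℝ F]
    {J : Set ℝ} (hJ : IsOpen J) {h g : ℝ → F} (hg : ContDiffOn ℝ ∞ g J)
    (hd : ∀ v ∈ J, HasDerivAt h (g v) v) : ContDiffOn ℝ ∞ h J :=
  (contDiffOn_infty_iff_deriv_of_isOpen hJ).2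
    ⟨fun v hv => (hd v hv).differentiableAt.differentiableWithinAt,
      hg.congr fun v hv => (hd v hv).deriv⟩

theorem isConformalTime_integral {I : Set ℝ} (hI : IsOpen I) (hI' : I.OrdConnected) {f : ℝ → ℝ}
    (hf : ContDiffOn ℝ ∞ f I) (hf0 : ∀ t ∈ I, f t ≠ 0) {u₀ : ℝ} (h0 : u₀ ∈ I) :
    IsConformalTime I f fun u => ∫ ξ in u₀..u, 1 / f ξ := by
  have hg : ContDiffOn ℝ ∞ (fun ξ => 1 / f ξ) I := contDiffOn_const.div hf hf0
  have hd := fun u (hu : u ∈ I) => hasDerivAt_primitive hI hI' hg.continuousOn h0 hu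
  exact ⟨contDiffOn_infty_of_hasDerivAt hI hg hd, hd⟩

theorem hasDerivAt_of_contDiffOn {F : Type*} [NormedAddCommGroup F] [NormedSpace ℝ F]
    {J : Set ℝ} (hJ : IsOpen J) {h : ℝ → F} (hh : ContDiffOn ℝ ∞ h J) {v : ℝ} (hv : v ∈ J) :
    HasDerivAt h (deriv h v) v :=
  ((hh.contDiffAt (hJ.mem_nhds hv)).differentiableAt (by simp)).hasDerivAt

theorem contDiffOn_deriv {F : Type*} [NormedAddCommGroup F] [NormedSpace ℝ F]
    {J : Set ℝ} (hJ : IsOpen J) {h : ℝ → F} (hh : ContDiffOn ℝ ∞ h J) :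
    ContDiffOn ℝ ∞ (deriv h) J :=
  ((contDiffOn_infty_iff_deriv_of_isOpen hJ).1 hh).2

theorem eq_of_hasDerivAt_zero {F : Type*} [NormedAddCommGroup F] [NormedSpace ℝ F]
    {J : Set ℝ} (hJ : IsOpen J) (hJ' : J.OrdConnected) {h : ℝ → F}
    (hd : ∀ v ∈ J, HasDerivAt h 0 v) {v₀ v : ℝ} (h0 : v₀ ∈ J) (hv : v ∈ J) : h v = h v₀ :=
  hJ.is_const_of_deriv_eq_zero hJ'.isPreconnected
    (fun v hv => (hd v hv).differentiableAt.differentiableWithinAt)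
    (fun v hv => (hd v hv).deriv) hv h0

/-- The derivative of an inner product which is constant on an open set. -/
theorem inner_deriv_add_eq_zero {J : Set ℝ} (hJ : IsOpen J) {a b : ℝ → E3} {a' b' : E3}
    {v c : ℝ} (hv : v ∈ J) (ha : HasDerivAt a a' v) (hb : HasDerivAt b b' v)
    (hc : ∀ s ∈ J, inner ℝ (a s) (b s) = c) : inner ℝ (a v) b' + inner ℝ a' (b v) = 0 := by
  have h1 := (ha.inner ℝ hb).congr_of_eventuallyEq (f₁ := fun _ => c) (by
    filter_upwards [hJ.mem_nhds hv] with s hs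
    exact (hc s hs).symm)
  exact h1.unique (hasDerivAt_const v c)

/-- The cross product of Euclidean three-space. -/
def cross (a b : E3) : E3 :=
  !₂[a 1 * b 2 - a 2 * b 1, a 2 * b 0 - a 0 * b 2, a 0 * b 1 - a 1 * b 0]

theorem inner_cross_left (a b : E3) : inner ℝ (cross a b) a = 0 := by
  simp [PiLp.inner_apply, Fin.sum_univ_three, cross]; ring

theorem inner_cross_right (a b : E3) : inner ℝ (cross a b) b = 0 := by
  simp [PiLp.inner_apply, Fin.sum_univ_three, cross]; ring

theorem norm_cross {a b : E3} (ha : ‖a‖ = 1) (hb : ‖b‖ = 1) (hab : inner ℝ a b = 0) :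
    ‖cross a b‖ = 1 := by
  have h : ‖cross a b‖ ^ 2 = ‖a‖ ^ 2 * ‖b‖ ^ 2 - inner ℝ a b ^ 2 := by
    simp only [EuclideanSpace.norm_sq_eq, Real.norm_eq_abs, sq_abs]
    simp [PiLp.inner_apply, Fin.sum_univ_three, cross]; ring
  rw [ha, hb, hab] at h
  have h1 := norm_nonneg (cross a b)
  nlinarith

theorem contDiffOn_cross {J : Set ℝ} {a b : ℝ → E3} (ha : ContDiffOn ℝ ∞ a J)
    (hb : ContDiffOn ℝ ∞ b J) : ContDiffOn ℝ ∞ (fun v => cross (a v) (b v)) J := by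
  have ha' := contDiffOn_euclidean.1 ha
  have hb' := contDiffOn_euclidean.1 hb
  refine contDiffOn_euclidean.2 fun i => ?_
  fin_cases i
  · exact ((ha' 1).mul (hb' 2)).sub ((ha' 2).mul (hb' 1))
  · exact ((ha' 2).mul (hb' 0)).sub ((ha' 0).mul (hb' 2))
  · exact ((ha' 0).mul (hb' 1)).sub ((ha' 1).mul (hb' 0))

/-- The orthonormal basis consisting of three orthogonal unit vectors of Euclidean space. -/
theorem exists_orthonormalBasis {a b c : E3} (ha : ‖a‖ = 1) (hb : ‖b‖ = 1) (hc : ‖c‖ = 1)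
    (hab : inner ℝ a b = 0) (hac : inner ℝ a c = 0) (hbc : inner ℝ b c = 0) :
    ∃ B : OrthonormalBasis (Fin 3) ℝ E3, B 0 = a ∧ B 1 = b ∧ B 2 = c := by
  have h : Orthonormal ℝ ![a, b, c] := by
    constructor
    · intro i; fin_cases i <;> simpa
    · intro i j hij
      have hba := real_inner_comm b a
      have hca := real_inner_comm c a
      have hcb := real_inner_comm c b
      fin_cases i <;> fin_cases j <;> simp_all
  have hcard : Fintype.card (Fin 3) = Module.finrank ℝ E3 := by simp
  refine ⟨(basisOfOrthonormalOfCardEqFinrank h hcard).toOrthonormalBasis (by simpa using h), ?_⟩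
  simp

theorem eq_sum_inner {a b c : E3} (ha : ‖a‖ = 1) (hb : ‖b‖ = 1) (hc : ‖c‖ = 1)
    (hab : inner ℝ a b = 0) (hac : inner ℝ a c = 0) (hbc : inner ℝ b c = 0) (x : E3) :
    x = inner ℝ a x • a + inner ℝ b x • b + inner ℝ c x • c := by
  obtain ⟨B, rfl, rfl, rfl⟩ := exists_orthonormalBasis ha hb hc hab hac hbc
  have h := B.sum_repr' x
  rw [Fin.sum_univ_three] at h
  exact h.symm

/-- The second Frenet equation of a spherical curve. -/
theorem IsSphericalCurve.deriv_normal {J : Set ℝ} {α n : ℝ → E3} {κ : ℝ → ℝ}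
    (h : IsSphericalCurve J α n κ) {v : ℝ} (hv : v ∈ J) :
    deriv n v = -(κ v • deriv α v) := by
  have dα := hasDerivAt_of_contDiffOn h.isOpen h.smooth hv
  have dα' := hasDerivAt_of_contDiffOn h.isOpen (contDiffOn_deriv h.isOpen h.smooth) hv
  have dn := hasDerivAt_of_contDiffOn h.isOpen h.smooth_normal hv
  have iαα' := inner_deriv_add_eq_zero h.isOpen hv dα dα (c := 1) fun s hs => by
    rw [real_inner_self_eq_norm_sq, h.norm_eq s hs, one_pow]
  rw [real_inner_comm (α v) (deriv α v), ← two_mul, mul_eq_zero,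
    or_iff_right two_ne_zero] at iαα'
  have h1 := inner_deriv_add_eq_zero h.isOpen hv dn dα h.inner_normal
  have h2 := inner_deriv_add_eq_zero h.isOpen hv dn dα' h.inner_normal_deriv
  have h3 := inner_deriv_add_eq_zero h.isOpen hv dn dn (c := 1) fun s hs => by
    rw [real_inner_self_eq_norm_sq, h.norm_normal s hs, one_pow]
  rw [h.inner_normal_deriv v hv, zero_add, real_inner_comm] at h1
  rw [h.deriv_deriv v hv, inner_sub_right, inner_smul_right, real_inner_self_eq_norm_sq,
    h.norm_normal v hv, h.inner_normal v hv, real_inner_comm] at h2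
  rw [real_inner_comm (n v) (deriv n v), ← two_mul, mul_eq_zero,
    or_iff_right two_ne_zero] at h3
  rw [eq_sum_inner (h.norm_eq v hv) (h.norm_deriv v hv) (h.norm_normal v hv)
    iαα' (by rw [real_inner_comm, h.inner_normal v hv])
    (by rw [real_inner_comm, h.inner_normal_deriv v hv]) (deriv n v), h1, h3,
    show inner ℝ (deriv α v) (deriv n v) = -κ v by linarith]
  module

/-- Reparameterization by arc length near a point of a regular curve `γ`: `L` is the arc length
function and `k` its inverse. -/
theorem exists_arclength {K : Set ℝ} (hK : IsOpen K) {γ : ℝ → E3}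
    (hγ : ContDiffOn ℝ ∞ γ K) {v₁ : ℝ} (hv₁ : v₁ ∈ K) (hne : deriv γ v₁ ≠ 0) :
    ∃ (L k : ℝ → ℝ) (K' J : Set ℝ), IsOpen K' ∧ v₁ ∈ K' ∧ K' ⊆ K ∧ IsOpen J ∧ J.OrdConnected ∧
      ContDiffOn ℝ ∞ L K' ∧ (∀ v ∈ K', deriv L v ≠ 0) ∧ (∀ v ∈ K', L v ∈ J ∧ k (L v) = v) ∧
      ContDiffOn ℝ ∞ k J ∧ (∀ s ∈ J, k s ∈ K') ∧ (∀ v ∈ K', deriv γ v ≠ 0) ∧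
      ∀ s ∈ J, HasDerivAt k ‖deriv γ (k s)‖⁻¹ s := by
  have hγ' := contDiffOn_deriv hK hγ
  -- an interval around `v₁` on which `γ` is regular
  obtain ⟨ε, hε, hball⟩ := Metric.isOpen_iff.1
    (hγ'.continuousOn.isOpen_inter_preimage hK isOpen_compl_singleton) v₁ ⟨hv₁, hne⟩
  set B := Metric.ball v₁ ε with hB
  have hBo : IsOpen B := Metric.isOpen_ball
  have hBc : B.OrdConnected := (convex_ball v₁ ε).ordConnected
  have hv₁B : v₁ ∈ B := Metric.mem_ball_self hε
  have hreg : ∀ v ∈ B, deriv γ v ≠ 0 := fun v hv => (hball hv).2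
  have hBK : B ⊆ K := fun v hv => (hball hv).1
  have hsp : ContDiffOn ℝ ∞ (fun v => ‖deriv γ v‖) B := (hγ'.mono hBK).norm ℝ hreg
  let L : ℝ → ℝ := fun u => ∫ ξ in v₁..u, ‖deriv γ ξ‖
  have hL : ∀ v ∈ B, HasDerivAt L ‖deriv γ v‖ v := fun v hv =>
    hasDerivAt_primitive hBo hBc hsp.continuousOn hv₁B hv
  have hLs : ContDiffOn ℝ ∞ L B := contDiffOn_infty_of_hasDerivAt hBo hsp hL
  have hLa : ∀ v ∈ B, ContDiffAt ℝ ∞ L v := fun v hv => hLs.contDiffAt (hBo.mem_nhds hv)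
  have hpos : ∀ v ∈ B, ‖deriv γ v‖ ≠ 0 := fun v hv => norm_ne_zero_iff.2 (hreg v hv)
  have hLe := (hL v₁ hv₁B).hasFDerivAt_equiv (hpos v₁ hv₁B)
  let g := ((hLa v₁ hv₁B).toOpenPartialHomeomorph L hLe (by simp)).restr B
  have hgs : v₁ ∈ g.source := by
    rw [OpenPartialHomeomorph.restr_source' _ _ hBo]
    exact ⟨(hLa v₁ hv₁B).mem_toOpenPartialHomeomorph_source hLe (by simp), hv₁B⟩
  have hgB : g.source ⊆ B := by
    rw [OpenPartialHomeomorph.restr_source' _ _ hBo]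
    exact Set.inter_subset_right
  obtain ⟨δ, hδ, hJ⟩ := Metric.isOpen_iff.1 g.open_target (L v₁) (g.map_source hgs)
  set J := Metric.ball (L v₁) δ with hJdef
  have hgL : ∀ v, g v = L v := fun v => rfl
  refine ⟨L, g.symm, g.source ∩ g ⁻¹' J, J, g.isOpen_inter_preimage Metric.isOpen_ball,
    ⟨hgs, Metric.mem_ball_self hδ⟩, fun v hv => hBK (hgB hv.1), Metric.isOpen_ball,
    (convex_ball _ _).ordConnected, hLs.mono fun v hv => hgB hv.1, fun v hv => ?_, fun v hv =>
    ⟨hv.2, g.left_inv hv.1⟩, fun s hs => ?_, fun s hs => ⟨g.map_target (hJ hs), ?_⟩,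
    fun v hv => hreg v (hgB hv.1), fun s hs => ?_⟩
  · rw [(hL v (hgB hv.1)).deriv]
    exact hpos v (hgB hv.1)
  · have hb := hgB (g.map_target (hJ hs))
    exact (g.contDiffAt_symm_deriv (hpos _ hb) (hJ hs) (hL _ hb) (hLa _ hb)).contDiffWithinAt
  · rwa [Set.mem_preimage, g.right_inv (hJ hs)]
  · have hb := hgB (g.map_target (hJ hs))
    exact g.hasDerivAt_symm (hJ hs) (hpos _ hb) (hL _ hb)

end Curves

/-! ### Ruled surfaces and the two normal forms -/

section Ruled

/-- The surface swept out, in the conformal time `S`, by the straight lines with direction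
`(1, w v)` through the points `y v` of a curve. -/
def ruled (S : ℝ → ℝ) (w y : ℝ → E3) (u v : ℝ) : RW := (u, S u • w v + y v)

/-- The conditions on `w` and `y` under which the normal field of the surface `ruled S w y` is
parallel: `w` has constant length `r`, and the derivatives of `w` and `y` are multiples of one
field `α` orthogonal to `w`. -/
structure IsRuledData (J : Set ℝ) (w y α : ℝ → E3) (r : ℝ) : Prop where
  isOpen : IsOpen J
  interval : J.OrdConnected
  smooth_w : ContDiffOn ℝ ∞ w J
  smooth_y : ContDiffOn ℝ ∞ y J
  norm_w : ∀ v ∈ J, ‖w v‖ = r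
  inner_w : ∀ v ∈ J, inner ℝ (α v) (w v) = 0
  deriv_w : ∀ v ∈ J, ∃ k : ℝ, deriv w v = k • α v
  deriv_y : ∀ v ∈ J, ∃ k : ℝ, deriv y v = k • α v

/-- Rotations solve the system `P' = κ Q`, `Q' = -κ P`, and they are the only solutions. -/
theorem exists_angle {J : Set ℝ} (hJ : IsOpen J) (hJ' : J.OrdConnected) {κ P Q : ℝ → ℝ} {r : ℝ}
    (hκ : ContDiffOn ℝ ∞ κ J) (hP : ∀ v ∈ J, HasDerivAt P (κ v * Q v) v)
    (hQ : ∀ v ∈ J, HasDerivAt Q (-(κ v * P v)) v) (hr : 0 ≤ r)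
    (hPQ : ∀ v ∈ J, P v ^ 2 + Q v ^ 2 = r ^ 2) :
    ∃ τ : ℝ → ℝ, ContDiffOn ℝ ∞ τ J ∧ (∀ v ∈ J, HasDerivAt τ (κ v) v) ∧
      ∀ v ∈ J, P v = r * Real.sin (τ v) ∧ Q v = r * Real.cos (τ v) := by
  rcases J.eq_empty_or_nonempty with rfl | ⟨v₁, hv₁⟩
  · exact ⟨0, contDiffOn_const, by simp, by simp⟩
  obtain ⟨τ₀, hs0, hc0⟩ : ∃ τ₀, P v₁ = r * Real.sin τ₀ ∧ Q v₁ = r * Real.cos τ₀ := by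
    have hn : ‖(⟨Q v₁, P v₁⟩ : ℂ)‖ = r := by
      rw [Complex.norm_eq_sqrt_sq_add_sq, add_comm, hPQ v₁ hv₁, Real.sqrt_sq hr]
    refine ⟨Complex.arg ⟨Q v₁, P v₁⟩, ?_, ?_⟩
    · rw [← hn, Complex.norm_mul_sin_arg]
    · rw [← hn, Complex.norm_mul_cos_arg]
  let τ : ℝ → ℝ := fun v => τ₀ + ∫ ξ in v₁..v, κ ξ
  have hτ : ∀ v ∈ J, HasDerivAt τ (κ v) v := fun v hv =>
    (hasDerivAt_primitive hJ hJ' hκ.continuousOn hv₁ hv).const_add τ₀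
  refine ⟨τ, contDiffOn_infty_of_hasDerivAt hJ hκ hτ, hτ, fun v hv => ?_⟩
  -- the square distance between the two solutions is constant, and vanishes at `v₁`
  let E : ℝ → ℝ := fun v => (P v - r * Real.sin (τ v)) ^ 2 + (Q v - r * Real.cos (τ v)) ^ 2
  have hE : ∀ v ∈ J, HasDerivAt E 0 v := fun v hv => by
    have h := (((hP v hv).sub ((hτ v hv).sin.const_mul r)).pow 2).add
      (((hQ v hv).sub ((hτ v hv).cos.const_mul r)).pow 2)
    refine h.congr_deriv ?_
    simp
    ring
  have h1 := eq_of_hasDerivAt_zero hJ hJ' hE hv₁ hv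
  have h2 : E v₁ = 0 := by simp [E, τ, hs0, hc0]
  rw [h2] at h1
  simp only [E] at h1
  constructor
  · nlinarith [sq_nonneg (P v - r * Real.sin (τ v)), sq_nonneg (Q v - r * Real.cos (τ v))]
  · nlinarith [sq_nonneg (P v - r * Real.sin (τ v)), sq_nonneg (Q v - r * Real.cos (τ v))]

/-- If `α` is parameterized by arc length, the ruled surface is of the spherical type. -/
theorem IsRuledData.exists_sphericalSurface {J : Set ℝ} {w y α : ℝ → E3} {r : ℝ}
    (h : IsRuledData J w y α r) (hα : ContDiffOn ℝ ∞ α J) (hn : ∀ v ∈ J, ‖α v‖ = 1)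
    (hd : ∀ v ∈ J, ‖deriv α v‖ = 1) (hr : 0 ≤ r) (f : ℝ → ℝ) (u₀ : ℝ) :
    ∃ (n : ℝ → E3) (κ τ A₁ A₄ A₅ : ℝ → ℝ), IsSphericalCurve J α n κ ∧
      IsSphericalData J κ τ A₁ A₄ A₅ ∧ ∀ u, ∀ v ∈ J,
        ruled (fun u => ∫ ξ in u₀..u, 1 / f ξ) w y u v =
          sphericalSurface f u₀ r α n τ A₁ A₄ A₅ u v := by
  have hJ := h.isOpen
  have hα' := contDiffOn_deriv hJ hα
  have hα'' := contDiffOn_deriv hJ hα'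
  let n : ℝ → E3 := fun v => cross (α v) (deriv α v)
  have hns : ContDiffOn ℝ ∞ n J := contDiffOn_cross hα hα'
  let κ : ℝ → ℝ := fun v => inner ℝ (n v) (deriv (deriv α) v)
  have hκ : ContDiffOn ℝ ∞ κ J := hns.inner ℝ hα''
  have dα : ∀ v ∈ J, HasDerivAt α (deriv α v) v := fun v hv => hasDerivAt_of_contDiffOn hJ hα hv
  have dα' : ∀ v ∈ J, HasDerivAt (deriv α) (deriv (deriv α) v) v := fun v hv =>
    hasDerivAt_of_contDiffOn hJ hα' hv
  have dn : ∀ v ∈ J, HasDerivAt n (deriv n v) v := fun v hv => hasDerivAt_of_contDiffOn hJ hns hv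
  have iαα : ∀ v ∈ J, inner ℝ (α v) (α v) = 1 := fun v hv => by
    rw [real_inner_self_eq_norm_sq, hn v hv, one_pow]
  have iα'α' : ∀ v ∈ J, inner ℝ (deriv α v) (deriv α v) = 1 := fun v hv => by
    rw [real_inner_self_eq_norm_sq, hd v hv, one_pow]
  have iαα' : ∀ v ∈ J, inner ℝ (α v) (deriv α v) = 0 := fun v hv => by
    have := inner_deriv_add_eq_zero hJ hv (dα v hv) (dα v hv) iαα
    rw [real_inner_comm (α v) (deriv α v)] at this
    linarith
  have iα'α : ∀ v ∈ J, inner ℝ (deriv α v) (α v) = 0 := fun v hv => by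
    rw [real_inner_comm]; exact iαα' v hv
  have inα : ∀ v ∈ J, inner ℝ (n v) (α v) = 0 := fun v _ => inner_cross_left _ _
  have inα' : ∀ v ∈ J, inner ℝ (n v) (deriv α v) = 0 := fun v _ => inner_cross_right _ _
  have iαn : ∀ v ∈ J, inner ℝ (α v) (n v) = 0 := fun v hv => by
    rw [real_inner_comm]; exact inα v hv
  have iα'n : ∀ v ∈ J, inner ℝ (deriv α v) (n v) = 0 := fun v hv => by
    rw [real_inner_comm]; exact inα' v hv
  have nn : ∀ v ∈ J, ‖n v‖ = 1 := fun v hv => norm_cross (hn v hv) (hd v hv) (iαα' v hv)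
  have expand : ∀ v ∈ J, ∀ x : E3, x = inner ℝ (α v) x • α v + inner ℝ (deriv α v) x • deriv α v +
      inner ℝ (n v) x • n v := fun v hv x =>
    eq_sum_inner (hn v hv) (hd v hv) (nn v hv) (iαα' v hv) (iαn v hv) (iα'n v hv) x
  have fr1 : ∀ v ∈ J, deriv (deriv α) v = κ v • n v - α v := fun v hv => by
    have h1 := inner_deriv_add_eq_zero hJ hv (dα v hv) (dα' v hv) iαα'
    have h2 := inner_deriv_add_eq_zero hJ hv (dα' v hv) (dα' v hv) iα'α'
    rw [real_inner_comm (deriv α v) (deriv (deriv α) v)] at h2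
    rw [iα'α' v hv] at h1
    have h3 : inner ℝ (α v) (deriv (deriv α) v) = -1 := by linarith
    have h4 : inner ℝ (deriv α v) (deriv (deriv α) v) = 0 := by linarith
    conv_lhs => rw [expand v hv (deriv (deriv α) v), h3, h4]
    simp only [κ]
    module
  have hcurve : IsSphericalCurve J α n κ :=
    ⟨hJ, h.interval, hα, hns, hκ, hn, hd, nn, inα, inα', fr1⟩
  have fr2 : ∀ v ∈ J, deriv n v = -(κ v • deriv α v) := fun v hv => hcurve.deriv_normal hv
  -- the components of a curve whose derivative is a multiple of `α`
  have comp : ∀ x : ℝ → E3, ContDiffOn ℝ ∞ x J → (∀ v ∈ J, ∃ k : ℝ, deriv x v = k • α v) →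
      ∀ v ∈ J, HasDerivAt (fun v => inner ℝ (deriv α v) (x v))
          (κ v * inner ℝ (n v) (x v) - inner ℝ (α v) (x v)) v ∧
        HasDerivAt (fun v => inner ℝ (n v) (x v)) (-(κ v * inner ℝ (deriv α v) (x v))) v := by
    intro x hx hx' v hv
    obtain ⟨k, hk⟩ := hx' v hv
    have dx := hasDerivAt_of_contDiffOn hJ hx hv
    constructor
    · refine ((dα' v hv).inner ℝ dx).congr_deriv ?_
      rw [hk, fr1 v hv, inner_smul_right, iα'α v hv, inner_sub_left, inner_smul_left]
      simp
    · refine ((dn v hv).inner ℝ dx).congr_deriv ?_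
      rw [hk, fr2 v hv, inner_smul_right, inα v hv, inner_neg_left, inner_smul_left]
      simp
  have hw := comp w h.smooth_w h.deriv_w
  have hy := comp y h.smooth_y h.deriv_y
  obtain ⟨τ, hτs, hτ, hPQ⟩ := exists_angle hJ h.interval hκ
    (P := fun v => inner ℝ (deriv α v) (w v)) (Q := fun v => inner ℝ (n v) (w v))
    (fun v hv => by simpa only [h.inner_w v hv, sub_zero] using (hw v hv).1)
    (fun v hv => (hw v hv).2) hr (fun v hv => by
      have h1 := congrArg (fun x => inner ℝ (w v) x) (expand v hv (w v))
      simp only [inner_add_right, inner_smul_right, real_inner_self_eq_norm_sq, h.norm_w v hv,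
        h.inner_w v hv, real_inner_comm (deriv α v) (w v), real_inner_comm (n v) (w v)] at h1
      rw [h1]
      ring)
  refine ⟨n, κ, τ, fun v => inner ℝ (α v) (y v), fun v => inner ℝ (deriv α v) (y v),
    fun v => inner ℝ (n v) (y v), hcurve,
    ⟨hτs, hα.inner ℝ h.smooth_y, hα'.inner ℝ h.smooth_y, hns.inner ℝ h.smooth_y,
      fun v hv => (hτ v hv).deriv, fun v hv => (hy v hv).1.deriv, fun v hv => (hy v hv).2.deriv⟩,
    fun u v hv => ?_⟩
  have hw1 := expand v hv (w v)
  rw [h.inner_w v hv, (hPQ v hv).1, (hPQ v hv).2] at hw1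
  simp only [ruled, sphericalSurface]
  ext1
  · rfl
  · conv_lhs => rw [hw1, expand v hv (y v)]
    module

/-- If `α` is constant and `y` is parameterized by arc length, the ruled surface is a cylinder. -/
theorem IsRuledData.exists_cylinder {J : Set ℝ} {w y : ℝ → E3} {a : E3} {r : ℝ}
    (h : IsRuledData J w y (fun _ => a) r) (ha : ‖a‖ = 1) (hd : ∀ v ∈ J, deriv y v = a)
    (hr : 0 < r) (f : ℝ → ℝ) (u₀ : ℝ) :
    ∃ A : E3 ≃ᵃⁱ[ℝ] E3, ∀ u, ∀ v ∈ J,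
      rigidMotion A (ruled (fun u => ∫ ξ in u₀..u, 1 / f ξ) w y u v) =
        cylinder f u₀ r 0 0 u v := by
  have hJ := h.isOpen
  rcases J.eq_empty_or_nonempty with rfl | ⟨v₁, hv₁⟩
  · exact ⟨AffineIsometryEquiv.refl ℝ E3, by simp⟩
  have hw : ∀ v ∈ J, w v = w v₁ := fun v hv => by
    refine eq_of_hasDerivAt_zero hJ h.interval (fun v hv => ?_) hv₁ hv
    have h1 := hasDerivAt_of_contDiffOn hJ h.smooth_w hv
    obtain ⟨k, hk⟩ := h.deriv_w v hv
    have h2 := inner_deriv_add_eq_zero hJ hv (hasDerivAt_const v a) h1 h.inner_w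
    rw [hk, inner_smul_right, real_inner_self_eq_norm_sq, ha] at h2
    simp at h2
    rwa [hk, h2, zero_smul] at h1
  have hy : ∀ v ∈ J, y v - v • a = y v₁ - v₁ • a := fun v hv => by
    refine eq_of_hasDerivAt_zero (h := fun v => y v - v • a) hJ h.interval (fun v hv => ?_) hv₁ hv
    have h1 := (hasDerivAt_of_contDiffOn hJ h.smooth_y hv).sub ((hasDerivAt_id v).smul_const a)
    rw [hd v hv] at h1
    exact h1.congr_deriv (by simp)
  set b : E3 := r⁻¹ • w v₁ with hb
  have hwb : w v₁ = r • b := by rw [hb, smul_smul, mul_inv_cancel₀ hr.ne', one_smul]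
  have hbn : ‖b‖ = 1 := by
    rw [hb, norm_smul, h.norm_w v₁ hv₁, norm_inv, Real.norm_of_nonneg hr.le,
      inv_mul_cancel₀ hr.ne']
  have hab : inner ℝ a b = 0 := by
    rw [hb, inner_smul_right, h.inner_w v₁ hv₁, mul_zero]
  obtain ⟨B, hB0, hB1, hB2⟩ := exists_orthonormalBasis hbn (norm_cross hbn ha
    (by rw [real_inner_comm, hab])) ha (by rw [real_inner_comm, inner_cross_left])
    (by rw [real_inner_comm, hab]) (inner_cross_right b a)
  refine ⟨(AffineIsometryEquiv.constVAdd ℝ E3 (-(y v₁ - v₁ • a))).trans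
    B.repr.toAffineIsometryEquiv, fun u v hv => ?_⟩
  have h1 : -(y v₁ - v₁ • a) + ((∫ ξ in u₀..u, 1 / f ξ) • w v + y v) =
      ((∫ ξ in u₀..u, 1 / f ξ) * r) • B 0 + v • B 2 := by
    rw [← hy v hv, hw v hv, hwb, hB0, hB2]
    module
  simp only [rigidMotion, ruled, cylinder]
  ext1
  · rfl
  · simp only [AffineIsometryEquiv.coe_trans, Function.comp, AffineIsometryEquiv.coe_constVAdd,
      vadd_eq_add, LinearIsometryEquiv.coe_toAffineIsometryEquiv]
    rw [h1, map_add, map_smul, map_smul, B.repr_self, B.repr_self]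
    ext i
    fin_cases i <;> simp [mul_comm]

end Ruled

/-! ### Adapted coordinates on a surface with parallel normal field -/

section Coordinates

theorem hasDerivAt_horizontal (u v : ℝ) : HasDerivAt (fun u : ℝ => (!₂[u, v] : Plane)) e₀ u := by
  have h : (fun u : ℝ => (!₂[u, v] : Plane)) = fun u => u • e₀ + v • e₁ := by
    ext u; rw [plane_eq !₂[u, v]]; simp
  rw [h]
  simpa using ((hasDerivAt_id u).smul_const e₀).add_const (v • e₁)

theorem hasDerivAt_vertical (u v : ℝ) : HasDerivAt (fun v : ℝ => (!₂[u, v] : Plane)) e₁ v := by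
  have h : (fun v : ℝ => (!₂[u, v] : Plane)) = fun v => u • e₀ + v • e₁ := by
    ext v; rw [plane_eq !₂[u, v]]; simp
  rw [h]
  simpa using ((hasDerivAt_id v).smul_const e₁).const_add (u • e₀)

theorem contDiff_vertical (u : ℝ) : ContDiff ℝ ∞ (fun v : ℝ => (!₂[u, v] : Plane)) := by
  refine contDiff_euclidean.2 fun i => ?_
  fin_cases i
  · exact contDiff_const
  · exact contDiff_id

theorem plane_eta (z : Plane) : !₂[z 0, z 1] = z := by
  ext i; fin_cases i <;> rfl

theorem eq_of_fderiv_e₀_eq_zero {F : Type*} [NormedAddCommGroup F] [NormedSpace ℝ F]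
    {A B : Set ℝ} (hA : IsOpen A) (hA' : A.OrdConnected) {g : Plane → F}
    (hg : ∀ z ∈ rectangle A B, DifferentiableAt ℝ g z)
    (h0 : ∀ z ∈ rectangle A B, fderiv ℝ g z e₀ = 0) {u₀ : ℝ} (hu : u₀ ∈ A) {z : Plane}
    (hz : z ∈ rectangle A B) : g z = g !₂[u₀, z 1] := by
  have h := eq_of_hasDerivAt_zero (h := fun u => g !₂[u, z 1]) hA hA' (fun u hu => by
    have hm : (!₂[u, z 1] : Plane) ∈ rectangle A B := ⟨hu, hz.2⟩
    have := (hg _ hm).hasFDerivAt.comp_hasDerivAt u (hasDerivAt_horizontal u (z 1))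
    rwa [h0 _ hm] at this) hu hz.1
  simpa only [plane_eta] using h

theorem hasFDerivAt_plane {g₀ g₁ : Plane → ℝ} {L₀ L₁ : Plane →L[ℝ] ℝ} {z : Plane}
    (h₀ : HasFDerivAt g₀ L₀ z) (h₁ : HasFDerivAt g₁ L₁ z) :
    HasFDerivAt (fun z => (!₂[g₀ z, g₁ z] : Plane)) (L₀.smulRight e₀ + L₁.smulRight e₁) z := by
  have h : (fun z => (!₂[g₀ z, g₁ z] : Plane)) = fun z => g₀ z • e₀ + g₁ z • e₁ := by
    ext z; rw [plane_eq !₂[g₀ z, g₁ z]]; simp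
  rw [h]
  exact (h₀.smul_const e₀).add (h₁.smul_const e₁)

theorem exists_ker_ne_zero (L : Plane →L[ℝ] ℝ) : ∃ X, X ≠ 0 ∧ L X = 0 := by
  have h := LinearMap.ker_ne_bot_of_finrank_lt (f := L.toLinearMap) (by simp)
  obtain ⟨X, hX, hX0⟩ := (Submodule.ne_bot_iff _).1 h
  exact ⟨X, hX0, hX⟩

end Coordinates

section Foot

variable {D : Set Plane} {Ψ : Plane → RW} {z : Plane} {c : ℝ}

/-- The point at time zero of the straight line through `Ψ z` in the direction of the tangential
part of `(1, 0)`, when the time component of the normal part is `1 + c`. -/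
def foot (c : ℝ) (Ψ : Plane → RW) (z : Plane) : E3 :=
  (Ψ z).2 - ((Ψ z).1 / c) • (etaFlat Ψ z).2

namespace IsFlatSurface

variable (h : IsFlatSurface D Ψ)
include h

theorem smooth_foot : ContDiffOn ℝ ∞ (foot c Ψ) D :=
  h.smooth.snd.sub ((h.smooth.fst.div_const c).smul h.smooth_etaFlat.snd)

theorem differentiableAt_foot (hz : z ∈ D) : DifferentiableAt ℝ (foot c Ψ) z :=
  (h.smooth_foot.contDiffAt (h.isOpen.mem_nhds hz)).differentiableAt (by simp)

theorem differentiableAt (hz : z ∈ D) : DifferentiableAt ℝ Ψ z :=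
  (h.smooth.contDiffAt (h.isOpen.mem_nhds hz)).differentiableAt (by simp)

theorem fderiv_foot (hz : z ∈ D) (X : Plane) :
    fderiv ℝ (foot c Ψ) z X = (fderiv ℝ Ψ z X).2 -
      (((Ψ z).1 / c) • (fderiv ℝ (etaFlat Ψ) z X).2 +
        ((fderiv ℝ Ψ z X).1 / c) • (etaFlat Ψ z).2) := by
  have h1 := (h.differentiableAt hz).hasFDerivAt
  have h2 := (h.differentiableAt_etaFlat hz).hasFDerivAt
  have h3 : HasFDerivAt (foot c Ψ) _ z := h1.snd.sub ((h1.fst.mul_const c⁻¹).smul h2.snd)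
  rw [h3.fderiv]
  simp [div_eq_mul_inv, mul_comm]

/-- The foot point is constant along the straight lines. -/
theorem fderiv_foot_tanFlat (hz : z ∈ D) (hp : IsParallelAt Ψ z) (hc : c ≠ 0)
    (h1 : (etaFlat Ψ z).1 = 1 + c) : fderiv ℝ (foot c Ψ) z (tanFlat Ψ z) = 0 := by
  rw [h.fderiv_foot hz, h.fderiv_etaFlat_tanFlat hz hp, fderiv_tanFlat]
  simp [h1, hc]

end IsFlatSurface

end Foot

section Fields

variable {M : Type*} [TopologicalSpace M] [ChartedSpace (EuclideanSpace ℝ (Fin 2)) M]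
  [IsManifold (𝓡 2) ∞ M]
  {I : Set ℝ} {f S : ℝ → ℝ} {φ : M → RW} {e : OpenPartialHomeomorph M Plane}

theorem isFlatSurface_flatten (hφ : IsSpacelikeSurface I f φ)
    (he : e ∈ IsManifold.maximalAtlas (𝓡 2) ∞ M) (hS : IsConformalTime I f S)
    (hf0 : ∀ t ∈ I, f t ≠ 0) : IsFlatSurface e.target (flatten S φ e) :=
  ⟨e.open_target, contDiffOn_flatten hφ he hS, fun _ => isSpacelikeMap_flatten hφ he hS hf0⟩

/-- The normal field of the surface in conformal time, as a field on the surface itself. -/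
def flatEta (f : ℝ → ℝ) (φ : M → RW) (p : M) : RW :=
  ((eta f φ p).1, f (φ p).1 • (eta f φ p).2)

theorem etaFlat_flatten (hφ : IsSpacelikeSurface I f φ)
    (he : e ∈ IsManifold.maximalAtlas (𝓡 2) ∞ M) (hS : IsConformalTime I f S)
    (hf0 : ∀ t ∈ I, f t ≠ 0) {z : Plane} (hz : z ∈ e.target) :
    etaFlat (flatten S φ e) z = flatEta f φ (e.symm z) := by
  have h0 := hf0 _ (hφ.mem (e.symm z))
  rw [flatEta, eta_eq hφ he hS hf0 hz]
  ext1
  · rfl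
  · simp [smul_smul, h0]

theorem HasParallelEta.isParallelAt (h : HasParallelEta f φ) (hφ : IsSpacelikeSurface I f φ)
    (he : e ∈ IsManifold.maximalAtlas (𝓡 2) ∞ M) (hS : IsConformalTime I f S)
    (hI : IsOpen I) (hf : ContDiffOn ℝ ∞ f I) (hf0 : ∀ t ∈ I, f t ≠ 0) {z : Plane}
    (hz : z ∈ e.target) : IsParallelAt (flatten S φ e) z :=
  (normalCovDeriv_eta_eq_zero_iff hφ he hS hI hf hf0 hz).1 (h _)

/-- If `η` is parallel, its time component, and with it the length of the gradient of the time
function, is constant. -/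
theorem HasParallelEta.eta_fst_eq [ConnectedSpace M] (h : HasParallelEta f φ)
    (hφ : IsSpacelikeSurface I f φ) (hI : IsOpen I) (hI' : I.OrdConnected)
    (hf : ContDiffOn ℝ ∞ f I) (hf0 : ∀ t ∈ I, f t ≠ 0) (p q : M) :
    (eta f φ p).1 = (eta f φ q).1 := by
  refine IsLocallyConstant.apply_eq_of_isPreconnected (f := fun p => (eta f φ p).1) ?_
    isPreconnected_univ (Set.mem_univ p) (Set.mem_univ q)
  refine (IsLocallyConstant.iff_eventually_eq _).2 fun p => ?_
  set e := chartAt (EuclideanSpace ℝ (Fin 2)) p with he'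
  have he : e ∈ IsManifold.maximalAtlas (𝓡 2) ∞ M := IsManifold.chart_mem_maximalAtlas p
  have hp : p ∈ e.source := mem_chart_source _ p
  have hS := isConformalTime_integral hI hI' hf hf0 (hφ.mem p)
  have hflat := isFlatSurface_flatten hφ he hS hf0
  obtain ⟨ε, hε, hb⟩ := Metric.isOpen_iff.1 e.open_target (e p) (e.map_source hp)
  have hcont := e.continuousAt hp
  filter_upwards [hcont.preimage_mem_nhds (Metric.ball_mem_nhds (e p) hε),
    e.open_source.mem_nhds hp] with q hq hqs
  have hfst : ∀ z ∈ Metric.ball (e p) ε,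
      HasFDerivAt (fun z => (etaFlat (flatten _ φ e) z).1) (0 : Plane →L[ℝ] ℝ) z := fun z hz => by
    have h1 := (hflat.differentiableAt_etaFlat (hb hz)).hasFDerivAt.fst
    refine h1.congr_fderiv ?_
    ext1 X
    exact hflat.fderiv_etaFlat_fst (hb hz) (h.isParallelAt hφ he hS hI hf hf0 (hb hz)) X
  have h1 := Metric.isOpen_ball.is_const_of_fderiv_eq_zero (𝕜 := ℝ)
    (convex_ball (e p) ε).isPreconnected
    (fun z hz => (hfst z hz).differentiableAt.differentiableWithinAt)
    (fun z hz => (hfst z hz).fderiv) hq (Metric.mem_ball_self hε)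
  rw [etaFlat_flatten hφ he hS hf0 (e.map_source hqs),
    etaFlat_flatten hφ he hS hf0 (e.map_source hp), e.left_inv hqs, e.left_inv hp] at h1
  exact h1

theorem one_lt_eta_fst (hφ : IsSpacelikeSurface I f φ) (hI : IsOpen I) (hI' : I.OrdConnected)
    (hf : ContDiffOn ℝ ∞ f I) (hf0 : ∀ t ∈ I, f t ≠ 0) {p : M}
    (hp : mfderiv (𝓡 2) 𝓘(ℝ, ℝ) (fun q => (φ q).1) p ≠ 0) : 1 < (eta f φ p).1 := by
  set e := chartAt (EuclideanSpace ℝ (Fin 2)) p with he'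
  have he : e ∈ IsManifold.maximalAtlas (𝓡 2) ∞ M := IsManifold.chart_mem_maximalAtlas p
  have hps : p ∈ e.source := mem_chart_source _ p
  have hS := isConformalTime_integral hI hI' hf hf0 (hφ.mem p)
  have hflat := isFlatSurface_flatten hφ he hS hf0
  have hz := e.map_source hps
  obtain ⟨X, hX⟩ : ∃ X, mfderiv (𝓡 2) 𝓘(ℝ, ℝ) (fun q => (φ q).1) p X ≠ 0 := by
    by_contra! hcon
    exact hp (ContinuousLinearMap.ext hcon)
  have hd : HasFDerivAt (φ ∘ e.symm) (fderiv ℝ (φ ∘ e.symm) (e p)) (e p) :=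
    (((contDiffOn_comp_symm hφ.smooth he).contDiffAt
      (e.open_target.mem_nhds hz)).differentiableAt (by simp)).hasFDerivAt
  have hd1 : HasFDerivAt ((fun q => (φ q).1) ∘ e.symm) _ (e p) := hd.fst
  rw [mfderiv_apply_eq_fderiv_chartDeriv he hps hd1.differentiableAt, hd1.fderiv] at hX
  have h1 := hflat.one_lt_etaFlat_fst hz (X := chartDeriv e p X) (by
    rw [fderiv_flatten hφ he hS hz]
    exact div_ne_zero hX (hf0 _ (hφ.mem _)))
  rwa [etaFlat_flatten hφ he hS hf0 hz, e.left_inv hps] at h1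

theorem foot_flatten (hφ : IsSpacelikeSurface I f φ)
    (he : e ∈ IsManifold.maximalAtlas (𝓡 2) ∞ M) (hS : IsConformalTime I f S)
    (hf0 : ∀ t ∈ I, f t ≠ 0) (c : ℝ) {z : Plane} (hz : z ∈ e.target) :
    foot c (flatten S φ e) z =
      (φ (e.symm z)).2 - (S (φ (e.symm z)).1 / c) • (flatEta f φ (e.symm z)).2 := by
  rw [foot, etaFlat_flatten hφ he hS hf0 hz]
  rfl

/-- Around every point there are coordinates consisting of the time function and of a linear
function of the foot point. -/
theorem exists_adapted_chart (h : HasParallelEta f φ) (hφ : IsSpacelikeSurface I f φ)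
    (hI : IsOpen I) (hf : ContDiffOn ℝ ∞ f I) (hf0 : ∀ t ∈ I, f t ≠ 0) {c : ℝ} (hc : 0 < c)
    (hη : ∀ p, (eta f φ p).1 = 1 + c) {p : M} {W : Set M} (hW : W ∈ 𝓝 p)
    (hS : IsConformalTime I f S) (hS0 : S (φ p).1 = 0) :
    ∃ e ∈ IsManifold.maximalAtlas (𝓡 2) ∞ M, ∃ (A K : Set ℝ) (a : E3), p ∈ e.source ∧
      e.source ⊆ W ∧ e.target = rectangle A K ∧ IsOpen A ∧ A.OrdConnected ∧ IsOpen K ∧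
      K.OrdConnected ∧ ∀ z ∈ e.target, (φ (e.symm z)).1 = z 0 ∧
        inner ℝ a (foot c (flatten S φ e) z) = z 1 := by
  set e := chartAt (EuclideanSpace ℝ (Fin 2)) p with he'
  have he : e ∈ IsManifold.maximalAtlas (𝓡 2) ∞ M := IsManifold.chart_mem_maximalAtlas p
  have hps : p ∈ e.source := mem_chart_source _ p
  have hflat := isFlatSurface_flatten hφ he hS hf0
  have hz := e.map_source hps
  have hpar := h.isParallelAt hφ he hS hI hf hf0 hz
  have hp0 : f (φ p).1 ≠ 0 := hf0 _ (hφ.mem p)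
  have hs0 : (flatten S φ e (e p)).1 = 0 := by simp [flatten, e.left_inv hps, hS0]
  have hη0 : (etaFlat (flatten S φ e) (e p)).1 = 1 + c := by
    rw [etaFlat_flatten hφ he hS hf0 hz]; exact hη _
  obtain ⟨X₀, hX₀, hX₀s⟩ := exists_ker_ne_zero
    (ContinuousLinearMap.fst ℝ ℝ E3 ∘L fderiv ℝ (flatten S φ e) (e p))
  replace hX₀s : (fderiv ℝ (flatten S φ e) (e p) X₀).1 = 0 := hX₀s
  set a := (fderiv ℝ (flatten S φ e) (e p) X₀).2 with ha
  have ha0 : inner ℝ a a ≠ 0 := by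
    have h1 := hflat.spacelike _ hz X₀ hX₀
    simp only [mink, hX₀s, ← ha, mul_zero, neg_zero, zero_add] at h1
    exact h1.ne'
  set T := tanFlat (flatten S φ e) (e p) with hT
  -- the derivatives of the two new coordinates along `T` and along the level set of the time;
  -- as `S` vanishes at `p`, foot point and surface have the same derivative along that level set
  have hd : HasFDerivAt (φ ∘ e.symm) (fderiv ℝ (φ ∘ e.symm) (e p)) (e p) :=
    (((contDiffOn_comp_symm hφ.smooth he).contDiffAt
      (e.open_target.mem_nhds hz)).differentiableAt (by simp)).hasFDerivAt
  have hd1 : HasFDerivAt (fun z => inner ℝ a (foot c (flatten S φ e) z)) _ (e p) :=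
    (innerSL ℝ a).hasFDerivAt.comp (e p) (hflat.differentiableAt_foot (c := c) hz).hasFDerivAt
  have hG := hasFDerivAt_plane hd.fst hd1
  have hfl := fun X => fderiv_flatten hφ he hS hz X
  simp only [e.left_inv hps] at hfl
  have t1 : (fderiv ℝ (φ ∘ e.symm) (e p) T).1 ≠ 0 := by
    intro h1
    have h2 := congrArg Prod.fst (fderiv_tanFlat (Ψ := flatten S φ e) (z := e p))
    rw [← hT, hfl, h1] at h2
    simp [hη0] at h2
    exact hc.ne' h2
  have t2 : fderiv ℝ (foot c (flatten S φ e)) (e p) T = 0 :=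
    hflat.fderiv_foot_tanFlat hz hpar hc.ne' hη0
  have t3 : (fderiv ℝ (φ ∘ e.symm) (e p) X₀).1 = 0 := by
    rw [hfl] at hX₀s
    simpa [hp0] using hX₀s
  have t4 : fderiv ℝ (foot c (flatten S φ e)) (e p) X₀ = a := by
    rw [hflat.fderiv_foot hz, hs0, hX₀s, ← ha]
    simp
  have hsm : ContDiffOn ℝ ∞ (fun z => (!₂[((φ ∘ e.symm) z).1,
      inner ℝ a (foot c (flatten S φ e) z)] : Plane)) e.target := by
    refine contDiffOn_euclidean.2 fun i => ?_
    fin_cases i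
    · exact (contDiffOn_comp_symm hφ.smooth he).fst
    · exact contDiffOn_const.inner ℝ hflat.smooth_foot
  obtain ⟨e', he'A, hpe', hsub, heq⟩ := exists_chart_comp he hps hW e.open_target hz hsm (by
    rw [hG.fderiv]
    intro Z
    refine ⟨(Z 0 / (fderiv ℝ (φ ∘ e.symm) (e p) T).1) • T + (Z 1 / inner ℝ a a) • X₀, ?_⟩
    conv_rhs => rw [plane_eq Z]
    simp only [map_add, map_smul, add_apply,
      ContinuousLinearMap.smulRight_apply, ContinuousLinearMap.comp_apply,
      ContinuousLinearMap.coe_fst', innerSL_apply_apply, t2, t3, t4, inner_zero_right, zero_smul,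
      add_zero, zero_add, smul_smul, div_mul_cancel₀ _ t1, div_mul_cancel₀ _ ha0])
  obtain ⟨δ, hδ, hrect⟩ := exists_rectangle_subset e'.open_target (e'.map_source hpe')
  obtain ⟨e'', he''A, htgt, hsrc, hcoe⟩ := exists_chart_target_eq he'A
    (isOpen_rectangle Metric.isOpen_ball Metric.isOpen_ball) hrect
  refine ⟨e'', he''A, _, _, a, ?_, ?_, htgt, Metric.isOpen_ball, (convex_ball _ _).ordConnected,
    Metric.isOpen_ball, (convex_ball _ _).ordConnected, fun z hz => ?_⟩
  · rw [hsrc]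
    exact ⟨hpe', Metric.mem_ball_self hδ, Metric.mem_ball_self hδ⟩
  · rw [hsrc]
    exact fun q hq => (hsub hq.1).1
  · have hq := e''.map_target hz
    have hq' : e''.symm z ∈ e'.source := by rw [hsrc] at hq; exact hq.1
    have h1 : e'' (e''.symm z) = z := e''.right_inv hz
    rw [hcoe, heq _ hq'] at h1
    have hqe := (hsub hq').2
    have h2 := congrArg (fun z : Plane => z 0) h1
    have h3 := congrArg (fun z : Plane => z 1) h1
    simp only [foot_flatten hφ he hS hf0 c (e.map_source hqe), e.left_inv hqe,
      Function.comp] at h2 h3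
    rw [foot_flatten hφ he''A hS hf0 c hz]
    exact ⟨h2, h3⟩

/-- In adapted coordinates a surface with parallel normal field is ruled. -/
theorem exists_ruled_chart (h : HasParallelEta f φ) (hφ : IsSpacelikeSurface I f φ)
    (hI : IsOpen I) (hf : ContDiffOn ℝ ∞ f I) (hf0 : ∀ t ∈ I, f t ≠ 0) {c : ℝ} (hc : 0 < c)
    (hη : ∀ p, (eta f φ p).1 = 1 + c) {p : M} {W : Set M} (hW : W ∈ 𝓝 p)
    (hS : IsConformalTime I f S) (hS0 : S (φ p).1 = 0) :
    ∃ e ∈ IsManifold.maximalAtlas (𝓡 2) ∞ M, ∃ (A K : Set ℝ) (w y : ℝ → E3) (r : ℝ),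
      p ∈ e.source ∧ e.source ⊆ W ∧ e.target = rectangle A K ∧ 0 < r ∧
      IsRuledData K w y (deriv y) r ∧ (∀ v ∈ K, deriv y v ≠ 0) ∧
      ∀ q ∈ e.source, φ q = ruled S w y (e q 0) (e q 1) := by
  obtain ⟨e, he, A, K, a, hp, hsub, htgt, hA, hA', hK, hK', hco⟩ :=
    exists_adapted_chart h hφ hI hf hf0 hc hη hW hS hS0
  have hflat := isFlatSurface_flatten hφ he hS hf0
  have hpar := fun z (hz : z ∈ e.target) => h.isParallelAt hφ he hS hI hf hf0 hz
  have hη0 : ∀ z ∈ e.target, (etaFlat (flatten S φ e) z).1 = 1 + c := fun z hz => by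
    rw [etaFlat_flatten hφ he hS hf0 hz]; exact hη _
  set Ψ := flatten S φ e with hΨ
  have hfz : ∀ z ∈ e.target, f (z 0) ≠ 0 := fun z hz => by
    rw [← (hco z hz).1]; exact hf0 _ (hφ.mem _)
  have ht : ∀ z ∈ e.target, ∀ X, (fderiv ℝ Ψ z X).1 = X 0 / f (z 0) := fun z hz X => by
    have hd : HasFDerivAt (φ ∘ e.symm) (fderiv ℝ (φ ∘ e.symm) z) z :=
      (((contDiffOn_comp_symm hφ.smooth he).contDiffAt
        (e.open_target.mem_nhds hz)).differentiableAt (by simp)).hasFDerivAt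
    have h1 := hd.fst.congr_of_eventuallyEq (f₁ := fun z : Plane => z 0) (by
      filter_upwards [e.open_target.mem_nhds hz] with z' hz'
      exact (hco z' hz').1.symm)
    have h2 := congrArg (fun L : Plane →L[ℝ] ℝ => L X)
      (h1.unique (EuclideanSpace.proj (𝕜 := ℝ) (0 : Fin 2)).hasFDerivAt)
    rw [hΨ, fderiv_flatten hφ he hS hz, (hco z hz).1]
    exact congrArg (· / f (z 0)) h2
  have ha : ∀ z ∈ e.target, ∀ X, inner ℝ a (fderiv ℝ (foot c Ψ) z X) = X 1 := fun z hz X => by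
    have h0 := (innerSL ℝ a).hasFDerivAt.comp z
      (hflat.differentiableAt_foot (c := c) hz).hasFDerivAt
    have h1 := h0.congr_of_eventuallyEq (f₁ := fun z : Plane => z 1) (by
      filter_upwards [e.open_target.mem_nhds hz] with z' hz'
      exact (hco z' hz').2.symm)
    exact congrArg (fun L : Plane →L[ℝ] ℝ => L X)
      (h1.unique (EuclideanSpace.proj (𝕜 := ℝ) (1 : Fin 2)).hasFDerivAt)
  -- the tangential part of `(1, 0)` is a multiple of the first coordinate field
  have hT : ∀ z ∈ e.target, tanFlat Ψ z = (-(c * f (z 0))) • e₀ := fun z hz => by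
    have h1 := congrArg Prod.fst (fderiv_tanFlat (Ψ := Ψ) (z := z))
    rw [ht z hz, Prod.fst_sub, hη0 z hz, div_eq_iff (hfz z hz)] at h1
    have h2 := ha z hz (tanFlat Ψ z)
    rw [hflat.fderiv_foot_tanFlat hz (hpar z hz) hc.ne' (hη0 z hz), inner_zero_right] at h2
    rw [plane_eq (tanFlat Ψ z), ← h2, h1, zero_smul, add_zero]
    congr 1
    ring
  have hTc : ∀ z ∈ e.target, -(c * f (z 0)) ≠ 0 := fun z hz =>
    neg_ne_zero.2 (mul_ne_zero hc.ne' (hfz z hz))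
  have dη : ∀ z ∈ e.target, fderiv ℝ (etaFlat Ψ) z e₀ = 0 := fun z hz => by
    have h1 := hflat.fderiv_etaFlat_tanFlat hz (hpar z hz)
    rw [hT z hz, map_smul] at h1
    exact (smul_eq_zero.1 h1).resolve_left (hTc z hz)
  have dfoot : ∀ z ∈ e.target, fderiv ℝ (foot c Ψ) z e₀ = 0 := fun z hz => by
    have h1 := hflat.fderiv_foot_tanFlat hz (hpar z hz) hc.ne' (hη0 z hz)
    rw [hT z hz, map_smul] at h1
    exact (smul_eq_zero.1 h1).resolve_left (hTc z hz)
  set u₀ := (φ p).1 with hu₀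
  have hzp : e p ∈ e.target := e.map_source hp
  have hu₀A : u₀ ∈ A := by
    have h1 := (hco _ hzp).1
    rw [e.left_inv hp, ← hu₀] at h1
    rw [htgt] at hzp
    rw [h1]
    exact hzp.1
  have hmem : ∀ v ∈ K, (!₂[u₀, v] : Plane) ∈ e.target := fun v hv => by
    rw [htgt]; exact ⟨hu₀A, hv⟩
  have cη : ∀ z ∈ e.target, etaFlat Ψ z = etaFlat Ψ !₂[u₀, z 1] := fun z hz => by
    rw [htgt] at dη hz
    exact eq_of_fderiv_e₀_eq_zero hA hA'
      (fun z hz => hflat.differentiableAt_etaFlat (by rwa [htgt])) dη hu₀A hz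
  have cfoot : ∀ z ∈ e.target, foot c Ψ z = foot c Ψ !₂[u₀, z 1] := fun z hz => by
    rw [htgt] at dfoot hz
    exact eq_of_fderiv_e₀_eq_zero hA hA'
      (fun z hz => hflat.differentiableAt_foot (by rwa [htgt])) dfoot hu₀A hz
  let w : ℝ → E3 := fun v => c⁻¹ • (etaFlat Ψ !₂[u₀, v]).2
  let y : ℝ → E3 := fun v => foot c Ψ !₂[u₀, v]
  have hvert : Set.MapsTo (fun v : ℝ => (!₂[u₀, v] : Plane)) K e.target := hmem
  have hws : ContDiffOn ℝ ∞ w K :=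
    (hflat.smooth_etaFlat.snd.comp (contDiff_vertical u₀).contDiffOn hvert).const_smul c⁻¹
  have hys : ContDiffOn ℝ ∞ y K :=
    hflat.smooth_foot.comp (contDiff_vertical u₀).contDiffOn hvert
  have ht1 : ∀ v ∈ K, (fderiv ℝ Ψ !₂[u₀, v] e₁).1 = 0 := fun v hv => by
    rw [ht _ (hmem v hv)]; simp
  have hdy : ∀ v ∈ K, deriv y v = (fderiv ℝ Ψ !₂[u₀, v] e₁).2 := fun v hv => by
    have hz := hmem v hv
    have h1 := (hflat.differentiableAt_foot (c := c) hz).hasFDerivAt.comp_hasDerivAt v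
      (hasDerivAt_vertical u₀ v)
    have h2 : (Ψ !₂[u₀, v]).1 = 0 := by
      have h3 := (hco _ hz).1
      rw [hΨ, flatten, h3]
      simpa using hS0
    rw [hflat.fderiv_foot hz, ht1 v hv, h2] at h1
    exact h1.deriv.trans (by simp)
  have hdw : ∀ v ∈ K, deriv w v = c⁻¹ • (fderiv ℝ (etaFlat Ψ) !₂[u₀, v] e₁).2 := fun v hv =>
    (((hflat.differentiableAt_etaFlat (hmem v hv)).hasFDerivAt.snd.comp_hasDerivAt v
      (hasDerivAt_vertical u₀ v)).const_smul c⁻¹).deriv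
  refine ⟨e, he, A, K, w, y, c⁻¹ * √((1 + c) * c), hp, hsub, htgt, by positivity,
    ⟨hK, hK', hws, hys, fun v hv => ?_, fun v hv => ?_, fun v hv => ?_, fun v hv =>
      ⟨1, (one_smul ℝ _).symm⟩⟩, fun v hv h0 => ?_, fun q hq => ?_⟩
  · have h1 := hflat.norm_etaFlat_snd (hmem v hv)
    rw [hη0 _ (hmem v hv), add_sub_cancel_left] at h1
    rw [← h1, Real.sqrt_sq (norm_nonneg _), norm_smul, norm_inv, Real.norm_of_nonneg hc.le]
  · have h1 := hflat.mink_etaFlat (hmem v hv) e₁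
    simp only [mink, ht1 v hv, mul_zero, neg_zero, zero_add] at h1
    rw [inner_smul_right, hdy v hv, real_inner_comm, h1, mul_zero]
  · obtain ⟨Z, hZ⟩ := hpar _ (hmem v hv) e₁
    have h1 := hflat.fderiv_etaFlat_fst (hmem v hv) (hpar _ (hmem v hv)) e₁
    rw [hZ, ht _ (hmem v hv), div_eq_zero_iff] at h1
    have h2 := h1.resolve_right (hfz _ (hmem v hv))
    refine ⟨c⁻¹ * Z 1, ?_⟩
    rw [hdw v hv, hZ, hdy v hv, map_plane _ Z, h2, zero_smul, zero_add, Prod.smul_snd, smul_smul]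
  · have h1 := ha _ (hmem v hv) e₁
    have h2 := (hflat.differentiableAt_foot (c := c) (hmem v hv)).hasFDerivAt.comp_hasDerivAt v
      (hasDerivAt_vertical u₀ v)
    rw [← h2.deriv] at h1
    rw [show foot c Ψ ∘ (fun v : ℝ => (!₂[u₀, v] : Plane)) = y from rfl, h0] at h1
    simp at h1
  · have hz := e.map_source hq
    have h1 := (hco _ hz).1
    have h2 := cη _ hz
    have h3 := cfoot _ hz
    have h4 : (φ q).2 = foot c Ψ (e q) + ((Ψ (e q)).1 / c) • (etaFlat Ψ (e q)).2 := by
      rw [foot, sub_add_cancel, hΨ, flatten, e.left_inv hq]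
    have h5 : (Ψ (e q)).1 = S (e q 0) := by rw [hΨ, flatten, h1]
    rw [e.left_inv hq] at h1
    ext1
    · exact h1
    · rw [h4, h5, h3, h2]
      simp only [ruled, w, y, smul_smul, div_eq_mul_inv]
      rw [add_comm]

end Fields

/-! ### Reparameterization of ruled surfaces -/

section Reparam

variable {J K : Set ℝ} {w y α : ℝ → E3} {r : ℝ}

theorem IsRuledData.congr_direction (h : IsRuledData K w y α r) {β : ℝ → E3}
    (hβ : ∀ v ∈ K, ∃ k : ℝ, k ≠ 0 ∧ α v = k • β v) : IsRuledData K w y β r where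
  isOpen := h.isOpen
  interval := h.interval
  smooth_w := h.smooth_w
  smooth_y := h.smooth_y
  norm_w := h.norm_w
  inner_w v hv := by
    obtain ⟨k, hk, hkα⟩ := hβ v hv
    have h1 := h.inner_w v hv
    rw [hkα, inner_smul_left] at h1
    exact (mul_eq_zero.1 h1).resolve_left (by simpa using hk)
  deriv_w v hv := by
    obtain ⟨k, -, hkα⟩ := hβ v hv
    obtain ⟨m, hm⟩ := h.deriv_w v hv
    exact ⟨m * k, by rw [hm, hkα, smul_smul]⟩
  deriv_y v hv := by
    obtain ⟨k, -, hkα⟩ := hβ v hv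
    obtain ⟨m, hm⟩ := h.deriv_y v hv
    exact ⟨m * k, by rw [hm, hkα, smul_smul]⟩

theorem IsRuledData.comp (h : IsRuledData K w y α r) (hJ : IsOpen J) (hJ' : J.OrdConnected)
    {k k' : ℝ → ℝ} (hk : ContDiffOn ℝ ∞ k J) (hkK : ∀ s ∈ J, k s ∈ K)
    (hd : ∀ s ∈ J, HasDerivAt k (k' s) s) :
    IsRuledData J (w ∘ k) (y ∘ k) (α ∘ k) r where
  isOpen := hJ
  interval := hJ'
  smooth_w := h.smooth_w.comp hk hkK
  smooth_y := h.smooth_y.comp hk hkK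
  norm_w s hs := h.norm_w _ (hkK s hs)
  inner_w s hs := h.inner_w _ (hkK s hs)
  deriv_w s hs := by
    obtain ⟨m, hm⟩ := h.deriv_w _ (hkK s hs)
    refine ⟨k' s * m, ?_⟩
    rw [((hasDerivAt_of_contDiffOn h.isOpen h.smooth_w (hkK s hs)).scomp s (hd s hs)).deriv, hm,
      smul_smul, Function.comp]
  deriv_y s hs := by
    obtain ⟨m, hm⟩ := h.deriv_y _ (hkK s hs)
    refine ⟨k' s * m, ?_⟩
    rw [((hasDerivAt_of_contDiffOn h.isOpen h.smooth_y (hkK s hs)).scomp s (hd s hs)).deriv, hm,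
      smul_smul, Function.comp]

theorem IsRuledData.map (h : IsRuledData K w y α r) (B : E3 ≃ᵃⁱ[ℝ] E3) :
    IsRuledData K (fun v => B.linearIsometryEquiv (w v)) (fun v => B (y v))
      (fun v => B.linearIsometryEquiv (α v)) r := by
  have hB : ∀ x, B x = B.linearIsometryEquiv x + B 0 := fun x => by
    simpa using B.map_vadd 0 x
  have hy : (fun v => B (y v)) = fun v => B.linearIsometryEquiv (y v) + B 0 := by
    ext1 v; rw [hB]
  let R : E3 →L[ℝ] E3 := B.linearIsometryEquiv.toContinuousLinearEquiv
  have hd : ∀ x : ℝ → E3, ContDiffOn ℝ ∞ x K → ∀ v ∈ K,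
      HasDerivAt (fun v => B.linearIsometryEquiv (x v)) (B.linearIsometryEquiv (deriv x v)) v :=
    fun x hx v hv => R.hasFDerivAt.comp_hasDerivAt v (hasDerivAt_of_contDiffOn h.isOpen hx hv)
  have hs : ∀ x : ℝ → E3, ContDiffOn ℝ ∞ x K →
      ContDiffOn ℝ ∞ (fun v => B.linearIsometryEquiv (x v)) K := fun x hx =>
    R.contDiff.comp_contDiffOn hx
  refine ⟨h.isOpen, h.interval, hs w h.smooth_w, ?_, fun v hv => ?_, fun v hv => ?_,
    fun v hv => ?_, fun v hv => ?_⟩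
  · rw [hy]; exact (hs y h.smooth_y).add contDiffOn_const
  · rw [LinearIsometryEquiv.norm_map, h.norm_w v hv]
  · rw [LinearIsometryEquiv.inner_map_map, h.inner_w v hv]
  · obtain ⟨k, hk⟩ := h.deriv_w v hv
    exact ⟨k, by rw [(hd w h.smooth_w v hv).deriv, hk, map_smul]⟩
  · obtain ⟨k, hk⟩ := h.deriv_y v hv
    exact ⟨k, by rw [hy, ((hd y h.smooth_y v hv).add_const _).deriv, hk, map_smul]⟩

theorem rigidMotion_ruled (B : E3 ≃ᵃⁱ[ℝ] E3) (S : ℝ → ℝ) (u v : ℝ) :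
    rigidMotion B (ruled S w y u v) =
      ruled S (fun v => B.linearIsometryEquiv (w v)) (fun v => B (y v)) u v := by
  simp only [rigidMotion, ruled]
  rw [← vadd_eq_add, B.map_vadd, map_smul, vadd_eq_add]

variable {M : Type*} [TopologicalSpace M] [ChartedSpace (EuclideanSpace ℝ (Fin 2)) M]
  [IsManifold (𝓡 2) ∞ M]

theorem exists_chart_reparam {e : OpenPartialHomeomorph M Plane}
    (he : e ∈ IsManifold.maximalAtlas (𝓡 2) ∞ M) {p : M} (hp : p ∈ e.source) (hK : IsOpen K)
    (hpK : e p 1 ∈ K) {L : ℝ → ℝ} (hL : ContDiffOn ℝ ∞ L K) (hL0 : deriv L (e p 1) ≠ 0) :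
    ∃ e' ∈ IsManifold.maximalAtlas (𝓡 2) ∞ M, p ∈ e'.source ∧ ∀ q ∈ e'.source,
      q ∈ e.source ∧ e q 1 ∈ K ∧ e' q 0 = e q 0 ∧ e' q 1 = L (e q 1) := by
  have hD := isOpen_rectangle isOpen_univ hK
  have hpD : e p ∈ rectangle Set.univ K := ⟨trivial, hpK⟩
  have hsm : ContDiffOn ℝ ∞ (fun z : Plane => (!₂[z 0, L (z 1)] : Plane))
      (rectangle Set.univ K) := by
    refine contDiffOn_euclidean.2 fun i => ?_
    fin_cases i
    · exact (by fun_prop : ContDiff ℝ ∞ fun z : Plane => z 0).contDiffOn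
    · exact hL.comp (by fun_prop : ContDiff ℝ ∞ fun z : Plane => z 1).contDiffOn
        fun z hz => hz.2
  have hG := hasFDerivAt_plane (EuclideanSpace.proj (𝕜 := ℝ) (0 : Fin 2)).hasFDerivAt
    ((hasDerivAt_of_contDiffOn hK hL hpK).comp_hasFDerivAt (e p)
      (EuclideanSpace.proj (𝕜 := ℝ) (1 : Fin 2)).hasFDerivAt)
  obtain ⟨e', he', hpe', hsub, heq⟩ := exists_chart_comp he hp
    (W := e.source ∩ e ⁻¹' rectangle Set.univ K)
    ((e.isOpen_inter_preimage hD).mem_nhds ⟨hp, hpD⟩) hD hpD hsm (by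
      refine fun Z => ⟨!₂[Z 0, Z 1 / deriv L (e p 1)], ?_⟩
      refine (congrArg (fun T : Plane →L[ℝ] Plane => T _) hG.fderiv).trans ?_
      conv_rhs => rw [plane_eq Z]
      simp [mul_div_cancel₀ _ hL0])
  refine ⟨e', he', hpe', fun q hq => ⟨(hsub hq).2, (hsub hq).1.2.2, ?_, ?_⟩⟩
  · rw [heq q hq]; rfl
  · rw [heq q hq]; rfl

end Reparam

/-! ### Normal forms of surfaces with parallel normal field -/

section Types

variable {M : Type*} [TopologicalSpace M] [ChartedSpace (EuclideanSpace ℝ (Fin 2)) M]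
  [IsManifold (𝓡 2) ∞ M] {I K : Set ℝ} {f : ℝ → ℝ} {φ : M → RW}
  {e : OpenPartialHomeomorph M Plane} {w y α : ℝ → E3} {r u₀ : ℝ} {p : M}

/-- Where the common direction `α` of the derivatives of `w` and `y` turns, the surface is of
spherical type. -/
theorem isTypeTwoNear_of_ruled (hmem : ∀ p, (φ p).1 ∈ I)
    (he : e ∈ IsManifold.maximalAtlas (𝓡 2) ∞ M) (hp : p ∈ e.source)
    (hK : ∀ q ∈ e.source, e q 1 ∈ K) (hu₀ : u₀ ∈ I) (h : IsRuledData K w y α r) (hr : 0 ≤ r)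
    (hα : ContDiffOn ℝ ∞ α K) (hαn : ∀ v ∈ K, ‖α v‖ = 1) (hd : deriv α (e p 1) ≠ 0)
    (hφ : ∀ q ∈ e.source, φ q = ruled (fun u => ∫ ξ in u₀..u, 1 / f ξ) w y (e q 0) (e q 1)) :
    IsTypeTwoNear I f φ p := by
  obtain ⟨L, k, K', J, hK', hpK', hK'K, hJ, hJ', hL, hL0, hLk, hk, hkK', hne, hdk⟩ :=
    exists_arclength h.isOpen hα (hK p hp) hd
  have hαd : ∀ s ∈ J, HasDerivAt (α ∘ k) (‖deriv α (k s)‖⁻¹ • deriv α (k s)) s := fun s hs =>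
    (hasDerivAt_of_contDiffOn h.isOpen hα (hK'K (hkK' s hs))).scomp s (hdk s hs)
  obtain ⟨n, κ, τ, A₁, A₄, A₅, hc, hdat, hsurf⟩ :=
    (h.comp hJ hJ' hk (fun s hs => hK'K (hkK' s hs)) hdk).exists_sphericalSurface
      (hα.comp hk fun s hs => hK'K (hkK' s hs)) (fun s hs => hαn _ (hK'K (hkK' s hs)))
      (fun s hs => by
        rw [(hαd s hs).deriv, norm_smul, norm_inv, norm_norm,
          inv_mul_cancel₀ (norm_ne_zero_iff.2 (hne _ (hkK' s hs)))]) hr f u₀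
  obtain ⟨e', he', hpe', hq'⟩ := exists_chart_reparam he hp hK' hpK' hL (hL0 _ hpK')
  refine ⟨u₀, hu₀, r, J, α ∘ k, n, κ, τ, A₁, A₄, A₅, hc, hdat, AffineIsometryEquiv.refl ℝ E3, e',
    he', hpe', fun q hq => ?_⟩
  obtain ⟨hqe, hqK, h0, h1⟩ := hq' q hq
  have hφq := hφ q hqe
  have hJq := hLk _ hqK
  refine ⟨?_, by rw [h1]; exact hJq.1, ?_⟩
  · have h2 := congrArg Prod.fst hφq
    simp only [ruled] at h2
    rw [h0, ← h2]
    exact hmem q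
  · rw [← hsurf _ _ (by rw [h1]; exact hJq.1), h0, h1]
    simp only [ruled, Function.comp, hJq.2]
    exact hφq

/-- If the direction `α` is constant, the surface is a cylinder. -/
theorem isTypeOneNear_of_ruled (hmem : ∀ p, (φ p).1 ∈ I)
    (he : e ∈ IsManifold.maximalAtlas (𝓡 2) ∞ M) (hp : p ∈ e.source)
    (hK : ∀ q ∈ e.source, e q 1 ∈ K) (hu₀ : u₀ ∈ I) {a : E3}
    (h : IsRuledData K w y (fun _ => a) r) (hr : 0 < r) (ha : ‖a‖ = 1)
    (hne : ∀ v ∈ K, deriv y v ≠ 0) (hd : ∀ v ∈ K, ‖deriv y v‖⁻¹ • deriv y v = a)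
    (hφ : ∀ q ∈ e.source, φ q = ruled (fun u => ∫ ξ in u₀..u, 1 / f ξ) w y (e q 0) (e q 1)) :
    IsTypeOneNear I f φ p := by
  obtain ⟨L, k, K', J, hK', hpK', hK'K, hJ, hJ', hL, hL0, hLk, hk, hkK', -, hdk⟩ :=
    exists_arclength h.isOpen h.smooth_y (hK p hp) (hne _ (hK p hp))
  obtain ⟨A, hA⟩ := (h.comp hJ hJ' hk (fun s hs => hK'K (hkK' s hs)) hdk).exists_cylinder ha
    (fun s hs => by
      rw [((hasDerivAt_of_contDiffOn h.isOpen h.smooth_y (hK'K (hkK' s hs))).scomp s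
        (hdk s hs)).deriv]
      exact hd _ (hK'K (hkK' s hs))) hr f u₀
  obtain ⟨e', he', hpe', hq'⟩ := exists_chart_reparam he hp hK' hpK' hL (hL0 _ hpK')
  refine ⟨u₀, hu₀, r, 0, 0, A, e', he', hpe', fun q hq => ?_⟩
  obtain ⟨hqe, hqK, h0, h1⟩ := hq' q hq
  have hφq := hφ q hqe
  have hJq := hLk _ hqK
  refine ⟨?_, trivial, ?_⟩
  · have h2 := congrArg Prod.fst hφq
    simp only [ruled] at h2
    rw [h0, ← h2]
    exact hmem q
  · rw [← hA _ _ (by rw [h1]; exact hJq.1), h0, h1, hφq]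
    simp only [ruled, Function.comp, hJq.2]

/-- Every neighbourhood of a point of a surface with parallel normal field meets the points near
which the surface has one of the two normal forms. -/
theorem exists_isType_of_parallel (h : HasParallelEta f φ) (hφ : IsSpacelikeSurface I f φ)
    (hI : IsOpen I) (hI' : I.OrdConnected) (hf : ContDiffOn ℝ ∞ f I) (hf0 : ∀ t ∈ I, f t ≠ 0)
    {c : ℝ} (hc : 0 < c) (hη : ∀ p, (eta f φ p).1 = 1 + c) {W : Set M} (hW : W ∈ 𝓝 p) :
    ∃ q ∈ W, IsTypeOneNear I f φ q ∨ IsTypeTwoNear I f φ q := by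
  have hS := isConformalTime_integral hI hI' hf hf0 (hφ.mem p)
  obtain ⟨e, he, A, K, w, y, r, hp, hsub, htgt, hr, hdat, hne, hsurf⟩ :=
    exists_ruled_chart h hφ hI hf hf0 hc hη hW hS (by simp)
  have hrect : ∀ q ∈ e.source, e q 0 ∈ A ∧ e q 1 ∈ K := fun q hq => by
    have := e.map_source hq
    rwa [htgt] at this
  set α : ℝ → E3 := fun v => ‖deriv y v‖⁻¹ • deriv y v with hαdef
  have hnn : ∀ v ∈ K, ‖deriv y v‖ ≠ 0 := fun v hv => norm_ne_zero_iff.2 (hne v hv)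
  have hys := contDiffOn_deriv hdat.isOpen hdat.smooth_y
  have hαs : ContDiffOn ℝ ∞ α K := ((hys.norm ℝ hne).inv hnn).smul hys
  have hαn : ∀ v ∈ K, ‖α v‖ = 1 := fun v hv => by
    rw [hαdef, norm_smul, norm_inv, norm_norm, inv_mul_cancel₀ (hnn v hv)]
  have hdatα : IsRuledData K w y α r := hdat.congr_direction fun v hv =>
    ⟨‖deriv y v‖, hnn v hv, by rw [hαdef, smul_smul, mul_inv_cancel₀ (hnn v hv), one_smul]⟩
  -- if `α` turns somewhere in `K`, a point of the chart with that parameter lies in `W`; if not,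
  -- the surface is a cylinder near `p` itself
  by_cases hturn : ∃ v ∈ K, deriv α v ≠ 0
  · obtain ⟨v, hv, hv0⟩ := hturn
    have hz : (!₂[e p 0, v] : Plane) ∈ e.target := by rw [htgt]; exact ⟨(hrect p hp).1, hv⟩
    have hq := e.map_target hz
    refine ⟨_, hsub hq, Or.inr (isTypeTwoNear_of_ruled hφ.mem he hq (fun q hq => (hrect q hq).2)
      (hφ.mem p) hdatα hr.le hαs hαn ?_ hsurf)⟩
    rw [e.right_inv hz]
    exact hv0
  · push Not at hturn
    have hpK := (hrect p hp).2
    have hconst : ∀ v ∈ K, α v = α (e p 1) := fun v hv =>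
      eq_of_hasDerivAt_zero hdat.isOpen hdat.interval (fun v hv => by
        have h1 := hasDerivAt_of_contDiffOn hdat.isOpen hαs hv
        rwa [hturn v hv] at h1) hpK hv
    exact ⟨p, mem_of_mem_nhds hW, Or.inl (isTypeOneNear_of_ruled hφ.mem he hp
      (fun q hq => (hrect q hq).2) (hφ.mem p)
      (hdatα.congr_direction fun v hv => ⟨1, one_ne_zero, by rw [one_smul, hconst v hv]⟩) hr
      (hαn _ hpK) hne hconst hsurf)⟩

end Types

/-! ### Ruled surfaces have parallel normal field -/

section Converse

variable {M : Type*} [TopologicalSpace M] [ChartedSpace (EuclideanSpace ℝ (Fin 2)) M]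
  [IsManifold (𝓡 2) ∞ M] {I J : Set ℝ} {f S : ℝ → ℝ} {φ : M → RW}
  {e : OpenPartialHomeomorph M Plane} {w y α : ℝ → E3} {r : ℝ} {p : M}

theorem IsRuledData.isParallelAt {D : Set Plane} {Ψ : Plane → RW} (h : IsRuledData J w y α r)
    (hflat : IsFlatSurface D Ψ) (hS : ∀ z ∈ D, ∃ s ≠ 0, HasDerivAt S s (z 0))
    (hJ : ∀ z ∈ D, z 1 ∈ J) (hΨ : ∀ z ∈ D, Ψ z = (S (z 0), S (z 0) • w (z 1) + y (z 1)))
    {z : Plane} (hz : z ∈ D) : IsParallelAt Ψ z := by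
  have proj : ∀ (i : Fin 2) (z : Plane),
      HasFDerivAt (fun z : Plane => z i) (EuclideanSpace.proj i : Plane →L[ℝ] ℝ) z := fun i z =>
    (EuclideanSpace.proj i : Plane →L[ℝ] ℝ).hasFDerivAt
  have hw := fun z (hz : z ∈ D) => hasDerivAt_of_contDiffOn h.isOpen h.smooth_w (hJ z hz)
  have hy := fun z (hz : z ∈ D) => hasDerivAt_of_contDiffOn h.isOpen h.smooth_y (hJ z hz)
  have dΨ : ∀ z ∈ D, ∃ s ≠ 0, ∀ X, fderiv ℝ Ψ z X = (X 0 * s, (X 0 * s) • w (z 1) +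
      X 1 • (S (z 0) • deriv w (z 1) + deriv y (z 1))) := fun z hz => by
    obtain ⟨s, hs0, hs⟩ := hS z hz
    refine ⟨s, hs0, fun X => ?_⟩
    have h1 := hs.comp_hasFDerivAt z (proj 0 z)
    have h2 := (hw z hz).hasFDerivAt.comp z (proj 1 z)
    have h3 := (hy z hz).hasFDerivAt.comp z (proj 1 z)
    have h4 := (h1.prodMk ((h1.smul h2).add h3)).congr_of_eventuallyEq (f₁ := Ψ) (by
      filter_upwards [hflat.isOpen.mem_nhds hz] with z' hz'
      exact hΨ z' hz')
    rw [h4.fderiv]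
    ext1
    · simp [mul_comm]
    · simp [smul_smul, mul_comm]
      module
  -- the rulings are space-like
  have hr : 1 < r ^ 2 := by
    obtain ⟨s, hs0, hs⟩ := dΨ z hz
    have h1 := hflat.spacelike z hz e₀ e₀_ne_zero
    rw [hs] at h1
    simp [mink, norm_smul, mul_pow, h.norm_w _ (hJ z hz)] at h1
    have h2 : 0 < s ^ 2 := by positivity
    nlinarith
  have hr1 : r ^ 2 - 1 ≠ 0 := by linarith
  have hww : ∀ z ∈ D, inner ℝ (w (z 1)) (w (z 1)) = r ^ 2 := fun z hz => by
    rw [real_inner_self_eq_norm_sq, h.norm_w _ (hJ z hz)]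
  have hη : ∀ z ∈ D, etaFlat Ψ z = (r ^ 2 / (r ^ 2 - 1), (r ^ 2 - 1)⁻¹ • w (z 1)) :=
    fun z hz => by
    obtain ⟨s, hs0, hs⟩ := dΨ z hz
    obtain ⟨k₁, hk₁⟩ := h.deriv_w _ (hJ z hz)
    obtain ⟨k₂, hk₂⟩ := h.deriv_y _ (hJ z hz)
    have hX : (1, 0) - fderiv ℝ Ψ z ((-(s⁻¹ * (r ^ 2 - 1)⁻¹)) • e₀) =
        (r ^ 2 / (r ^ 2 - 1), (r ^ 2 - 1)⁻¹ • w (z 1)) := by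
      rw [hs]
      ext1
      · simp
        field_simp
        ring
      · simp [mul_right_comm, hs0]
    rw [etaFlat, ← (hflat.spacelike z hz).eq_tanCoef (W := (1, 0)) (fun Y => ?_), hX]
    rw [hX, hs]
    simp only [mink, hk₁, hk₂, inner_add_right, inner_smul_left, inner_smul_right, hww z hz,
      real_inner_comm (α (z 1)) (w (z 1)), h.inner_w _ (hJ z hz)]
    simp
    field_simp
    ring
  intro X
  obtain ⟨s, hs0, hs⟩ := dΨ z hz
  obtain ⟨k₁, hk₁⟩ := h.deriv_w _ (hJ z hz)
  obtain ⟨k₂, hk₂⟩ := h.deriv_y _ (hJ z hz)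
  have h1 := ((hasFDerivAt_const (r ^ 2 / (r ^ 2 - 1)) z).prodMk
    (((hw z hz).hasFDerivAt.comp z (proj 1 z)).const_smul
    (r ^ 2 - 1)⁻¹)).congr_of_eventuallyEq (f₁ := etaFlat Ψ) (by
      filter_upwards [hflat.isOpen.mem_nhds hz] with z' hz'
      exact hη z' hz')
  -- the image of the second coordinate vector is a multiple of `α`, nonzero by regularity
  have hm : S (z 0) * k₁ + k₂ ≠ 0 := fun h0 => by
    have h2 := hflat.spacelike z hz e₁ (fun h => by
      have := congrArg (fun X : Plane => X 1) h; simp [e₁] at this)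
    rw [hs, hk₁, hk₂, smul_smul, ← add_smul, h0] at h2
    simp [mink] at h2
  refine ⟨(X 1 * k₁ / ((r ^ 2 - 1) * (S (z 0) * k₁ + k₂))) • e₁, ?_⟩
  rw [h1.fderiv, hs, hk₁, hk₂]
  ext1
  · simp
  · simp [smul_smul, ← add_smul]
    congr 1
    field_simp
    rw [mul_div_assoc, div_self (by rwa [mul_comm k₁]), mul_one]

theorem normalCovDeriv_eq_zero_of_ruled (hφ : IsSpacelikeSurface I f φ)
    (he : e ∈ IsManifold.maximalAtlas (𝓡 2) ∞ M) (hS : IsConformalTime I f S)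
    (hI : IsOpen I) (hf : ContDiffOn ℝ ∞ f I) (hf0 : ∀ t ∈ I, f t ≠ 0)
    (h : IsRuledData J w y α r) (hp : p ∈ e.source) (hJ : ∀ q ∈ e.source, e q 0 ∈ I ∧ e q 1 ∈ J)
    {A : E3 ≃ᵃⁱ[ℝ] E3}
    (hsurf : ∀ q ∈ e.source, rigidMotion A (φ q) = ruled S w y (e q 0) (e q 1)) :
    ∀ X, normalCovDeriv f φ (eta f φ) p X = 0 := by
  have hJz : ∀ z ∈ e.target, z 0 ∈ I ∧ z 1 ∈ J := fun z hz => by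
    have := hJ _ (e.map_target hz)
    rwa [e.right_inv hz] at this
  have key := (normalCovDeriv_eta_eq_zero_iff hφ he hS hI hf hf0 (e.map_source hp)).2
    ((h.map A.symm).isParallelAt (S := S) (isFlatSurface_flatten hφ he hS hf0)
      (fun z hz => ⟨_, one_div_ne_zero (hf0 _ (hJz z hz).1), hS.hasDerivAt _ (hJz z hz).1⟩)
      (fun z hz => (hJz z hz).2) (fun z hz => by
        have h1 := congrArg (rigidMotion A.symm) (hsurf _ (e.map_target hz))
        rw [rigidMotion_ruled, e.right_inv hz] at h1
        have h2 : rigidMotion A.symm (rigidMotion A (φ (e.symm z))) = φ (e.symm z) := by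
          simp [rigidMotion]
        rw [h2] at h1
        rw [flatten, h1]
        rfl) (e.map_source hp))
  rwa [e.left_inv hp] at key

theorem isRuledData_cylinder (c₁ c₂ c₃ : ℝ) :
    IsRuledData Set.univ (fun _ => !₂[c₁, c₂, 0]) (fun v => !₂[0, c₃, v]) (fun _ => !₂[0, 0, 1])
      ‖(!₂[c₁, c₂, 0] : E3)‖ := by
  have hy : (fun v : ℝ => (!₂[0, c₃, v] : E3)) = fun v => !₂[0, c₃, 0] + v • !₂[0, 0, 1] := by
    ext v i; fin_cases i <;> simp
  have hd : ∀ v, HasDerivAt (fun v : ℝ => (!₂[0, c₃, v] : E3)) !₂[0, 0, 1] v := fun v => by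
    rw [hy]
    simpa using ((hasDerivAt_id v).smul_const (!₂[0, 0, 1] : E3)).const_add !₂[0, c₃, 0]
  refine ⟨isOpen_univ, Set.ordConnected_univ, contDiffOn_const, ?_, fun _ _ => rfl, fun v _ => ?_,
    fun v _ => ⟨0, by simp⟩, fun v _ => ⟨1, by rw [(hd v).deriv, one_smul]⟩⟩
  · rw [hy]
    exact contDiffOn_const.add (contDiffOn_id.smul contDiffOn_const)
  · simp [PiLp.inner_apply, Fin.sum_univ_three]

theorem cylinder_eq_ruled (u₀ c₁ c₂ c₃ u v : ℝ) : cylinder f u₀ c₁ c₂ c₃ u v =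
    ruled (fun u => ∫ ξ in u₀..u, 1 / f ξ) (fun _ => !₂[c₁, c₂, 0]) (fun v => !₂[0, c₃, v])
      u v := by
  simp only [cylinder, ruled]
  ext1
  · rfl
  · ext i
    fin_cases i <;> simp [mul_comm]

theorem isRuledData_spherical {n : ℝ → E3} {κ τ A₁ A₄ A₅ : ℝ → ℝ}
    (h : IsSphericalCurve J α n κ) (hd : IsSphericalData J κ τ A₁ A₄ A₅) (c : ℝ) :
    IsRuledData J (fun v => (c * Real.sin (τ v)) • deriv α v + (c * Real.cos (τ v)) • n v)
      (fun v => A₁ v • α v + A₄ v • deriv α v + A₅ v • n v) α |c| := by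
  have hJ := h.isOpen
  have hα' := contDiffOn_deriv hJ h.smooth
  have dα := fun v (hv : v ∈ J) => hasDerivAt_of_contDiffOn hJ h.smooth hv
  have dα' : ∀ v ∈ J, HasDerivAt (deriv α) (κ v • n v - α v) v := fun v hv => by
    rw [← h.deriv_deriv v hv]; exact hasDerivAt_of_contDiffOn hJ hα' hv
  have dn : ∀ v ∈ J, HasDerivAt n (-(κ v • deriv α v)) v := fun v hv => by
    rw [← h.deriv_normal hv]; exact hasDerivAt_of_contDiffOn hJ h.smooth_normal hv
  have dτ : ∀ v ∈ J, HasDerivAt τ (κ v) v := fun v hv => by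
    rw [← hd.deriv_τ v hv]; exact hasDerivAt_of_contDiffOn hJ hd.smooth_τ hv
  have dA₁ := fun v (hv : v ∈ J) => hasDerivAt_of_contDiffOn hJ hd.smooth_A₁ hv
  have dA₄ : ∀ v ∈ J, HasDerivAt A₄ (κ v * A₅ v - A₁ v) v := fun v hv => by
    rw [← hd.deriv_A₄ v hv]; exact hasDerivAt_of_contDiffOn hJ hd.smooth_A₄ hv
  have dA₅ : ∀ v ∈ J, HasDerivAt A₅ (-(κ v * A₄ v)) v := fun v hv => by
    rw [← hd.deriv_A₅ v hv]; exact hasDerivAt_of_contDiffOn hJ hd.smooth_A₅ hv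
  have iαα' : ∀ v ∈ J, inner ℝ (α v) (deriv α v) = 0 := fun v hv => by
    have h1 := inner_deriv_add_eq_zero hJ hv (dα v hv) (dα v hv) (c := 1) fun s hs => by
      rw [real_inner_self_eq_norm_sq, h.norm_eq s hs, one_pow]
    rw [real_inner_comm (α v) (deriv α v)] at h1
    linarith
  refine ⟨hJ, h.interval, ?_, ?_, fun v hv => ?_, fun v hv => ?_,
    fun v hv => ⟨-(c * Real.sin (τ v)), ?_⟩, fun v hv => ⟨deriv A₁ v - A₄ v, ?_⟩⟩
  · exact ((contDiffOn_const.mul hd.smooth_τ.sin).smul hα').add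
      ((contDiffOn_const.mul hd.smooth_τ.cos).smul h.smooth_normal)
  · exact ((hd.smooth_A₁.smul h.smooth).add (hd.smooth_A₄.smul hα')).add
      (hd.smooth_A₅.smul h.smooth_normal)
  · rw [← sq_eq_sq₀ (norm_nonneg _) (abs_nonneg c), sq_abs, ← real_inner_self_eq_norm_sq]
    simp only [inner_add_left, inner_add_right, real_inner_smul_left, inner_smul_right,
      real_inner_self_eq_norm_sq, h.norm_deriv v hv, h.norm_normal v hv, h.inner_normal_deriv v hv,
      real_inner_comm (n v) (deriv α v)]
    linear_combination c ^ 2 * Real.sin_sq_add_cos_sq (τ v)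
  · rw [inner_add_right, inner_smul_right, inner_smul_right, iαα' v hv,
      real_inner_comm, h.inner_normal v hv]
    simp
  · refine ((((dτ v hv).sin.const_mul c).smul (dα' v hv)).add
      (((dτ v hv).cos.const_mul c).smul (dn v hv))).deriv.trans ?_
    module
  · refine ((((dA₁ v hv).smul (dα v hv)).add ((dA₄ v hv).smul (dα' v hv))).add
      ((dA₅ v hv).smul (dn v hv))).deriv.trans ?_
    module

theorem sphericalSurface_eq_ruled (u₀ c : ℝ) (n : ℝ → E3) (τ A₁ A₄ A₅ : ℝ → ℝ) (u v : ℝ) :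
    sphericalSurface f u₀ c α n τ A₁ A₄ A₅ u v =
      ruled (fun u => ∫ ξ in u₀..u, 1 / f ξ)
        (fun v => (c * Real.sin (τ v)) • deriv α v + (c * Real.cos (τ v)) • n v)
        (fun v => A₁ v • α v + A₄ v • deriv α v + A₅ v • n v) u v := by
  simp only [sphericalSurface, ruled]
  ext1
  · rfl
  · module

/-- On a surface with one of the two normal forms near `p`, `η` is parallel at `p`. -/
theorem normalCovDeriv_eq_zero_of_isType (hφ : IsSpacelikeSurface I f φ)
    (hI : IsOpen I) (hI' : I.OrdConnected) (hf : ContDiffOn ℝ ∞ f I) (hf0 : ∀ t ∈ I, f t ≠ 0)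
    (h : IsTypeOneNear I f φ p ∨ IsTypeTwoNear I f φ p) :
    ∀ X, normalCovDeriv f φ (eta f φ) p X = 0 := by
  rcases h with ⟨u₀, hu₀, c₁, c₂, c₃, A, e, he, hp, hq⟩ |
    ⟨u₀, hu₀, c, J, α, n, κ, τ, A₁, A₄, A₅, hc, hd, A, e, he, hp, hq⟩
  · exact normalCovDeriv_eq_zero_of_ruled hφ he (isConformalTime_integral hI hI' hf hf0 hu₀) hI hf
      hf0 (isRuledData_cylinder c₁ c₂ c₃) hp (fun q h => ⟨(hq q h).1, (hq q h).2.1⟩)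
      (fun q h => by rw [(hq q h).2.2, cylinder_eq_ruled])
  · exact normalCovDeriv_eq_zero_of_ruled hφ he (isConformalTime_integral hI hI' hf hf0 hu₀) hI hf
      hf0 (isRuledData_spherical hc hd c) hp (fun q h => ⟨(hq q h).1, (hq q h).2.1⟩)
      (fun q h => by rw [(hq q h).2.2, sphericalSurface_eq_ruled])

/-- It suffices that `η` is parallel on a dense set. -/
theorem hasParallelEta_of_dense (hφ : IsSpacelikeSurface I f φ)
    (hI : IsOpen I) (hI' : I.OrdConnected) (hf : ContDiffOn ℝ ∞ f I) (hf0 : ∀ t ∈ I, f t ≠ 0)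
    {U : Set M} (hU : Dense U) (h : ∀ p ∈ U, ∀ X, normalCovDeriv f φ (eta f φ) p X = 0) :
    HasParallelEta f φ := by
  intro p
  set e := chartAt (EuclideanSpace ℝ (Fin 2)) p with he'
  have he : e ∈ IsManifold.maximalAtlas (𝓡 2) ∞ M := IsManifold.chart_mem_maximalAtlas p
  have hp : p ∈ e.source := mem_chart_source _ p
  have hz := e.map_source hp
  have hS := isConformalTime_integral hI hI' hf hf0 (hφ.mem p)
  have hflat := isFlatSurface_flatten hφ he hS hf0
  have hclos : e p ∈ closure (e.symm ⁻¹' U ∩ e.target) := by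
    refine mem_closure_iff_nhds.2 fun N hN => ?_
    obtain ⟨q, ⟨hqN, hqs⟩, hqU⟩ := mem_closure_iff_nhds.1 (hU p) _
      (inter_mem ((e.continuousAt hp).preimage_mem_nhds hN) (e.open_source.mem_nhds hp))
    exact ⟨e q, hqN, by rwa [Set.mem_preimage, e.left_inv hqs], e.map_source hqs⟩
  have key := (normalCovDeriv_eta_eq_zero_iff hφ he hS hI hf hf0 hz).2
    (hflat.isParallelAt_of_mem_closure (s := e.symm ⁻¹' U) (fun z hz' =>
      (normalCovDeriv_eta_eq_zero_iff hφ he hS hI hf hf0 hz'.2).1 (h _ hz'.1)) hz hclos)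
  rwa [e.left_inv hp] at key

theorem CongruentNear.eventually {ψ : ℝ → ℝ → RW} (h : CongruentNear I J φ p ψ) :
    ∀ᶠ q in 𝓝 p, CongruentNear I J φ q ψ := by
  obtain ⟨A, e, he, hp, hq⟩ := h
  filter_upwards [e.open_source.mem_nhds hp] with q hqs
  exact ⟨A, e, he, hqs, hq⟩

theorem isOpen_isType : IsOpen {p : M | IsTypeOneNear I f φ p ∨ IsTypeTwoNear I f φ p} := by
  refine isOpen_iff_mem_nhds.2 fun p hp => ?_
  rcases hp with ⟨u₀, hu₀, c₁, c₂, c₃, hc⟩ |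
    ⟨u₀, hu₀, c, J, α, n, κ, τ, A₁, A₄, A₅, h1, h2, hc⟩
  · filter_upwards [hc.eventually] with q hq
    exact Or.inl ⟨u₀, hu₀, c₁, c₂, c₃, hq⟩
  · filter_upwards [hc.eventually] with q hq
    exact Or.inr ⟨u₀, hu₀, c, J, α, n, κ, τ, A₁, A₄, A₅, h1, h2, hq⟩

end Converse

end RobertsonWalker
end

theorem mainTheorem3 {M : Type*} [TopologicalSpace M]
    [ChartedSpace (EuclideanSpace ℝ (Fin 2)) M] [IsManifold (𝓡 2) ∞ M] [ConnectedSpace M]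
    (I : Set ℝ) (hI : IsOpen I) (hI' : I.OrdConnected)
    (f : ℝ → ℝ) (hf : ContDiffOn ℝ ∞ f I) (hf0 : ∀ t ∈ I, f t ≠ 0)
    (φ : M → RobertsonWalker.RW) (hφ : RobertsonWalker.IsSpacelikeSurface I f φ)
    (hgrad : ∃ p : M, mfderiv (𝓡 2) 𝓘(ℝ, ℝ) (fun q => (φ q).1) p ≠ 0) :
    RobertsonWalker.HasParallelEta f φ ↔
      ∃ U : Set M, IsOpen U ∧ Dense U ∧
        ∀ p ∈ U, RobertsonWalker.IsTypeOneNear I f φ p ∨ RobertsonWalker.IsTypeTwoNear I f φ p := by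
  constructor
  · intro h
    obtain ⟨p₀, hp₀⟩ := hgrad
    have h1 := RobertsonWalker.one_lt_eta_fst hφ hI hI' hf hf0 hp₀
    refine ⟨_, RobertsonWalker.isOpen_isType, dense_iff_inter_open.2 fun W hW ⟨p, hp⟩ => ?_,
      fun p hp => hp⟩
    obtain ⟨q, hq, hq'⟩ := RobertsonWalker.exists_isType_of_parallel h hφ hI hI' hf hf0
      (sub_pos.2 h1) (fun p => by rw [h.eta_fst_eq hφ hI hI' hf hf0 p p₀]; ring)
      (hW.mem_nhds hp)
    exact ⟨q, hq, hq'⟩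
  · rintro ⟨U, -, hU, h⟩
    exact RobertsonWalker.hasParallelEta_of_dense hφ hI hI' hf hf0 hU fun p hp =>
      RobertsonWalker.normalCovDeriv_eq_zero_of_isType hφ hI hI' hf hf0 (h p hp)
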